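/- Let $\mathcal X_1,\mathcal X_2$ be finite alphabets and let $P=P_{X_1X_2}$ be a probability mass function on $\mathcal X_1\times\mathcal X_2$. Consider the discrete memoryless multiple source with $P_{X_1^nX_2^n}(\mathbf x_1,\mathbf x_2)=\prod_{i=1}^n P(x_{1i},x_{2i})$. Logarithms are to the base $2$, and $H$ denotes (joint, conditional) Shannon entropy. An $(M_1,M_2,\varepsilon)$-code for $(X_1^n,X_2^n)$ consists of encoders $f_j:\mathcal X_j^n\to\{1,\dots,M_j\}$, $j=1,2$, and a decoder $\varphi:\{1,\dots,M_1\}\times\{1,\dots,M_2\}\to\mathcal X_1^n\times\mathcal X_2^n$ with $\Pr\big(\varphi(f_1(X_1^n),f_2(X_2^n))\ne(X_1^n,X_2^n)\big)\le\varepsilon$. For real numbers $\varepsilon,R_1^*,R_2^*$, let $\mathcal L(\varepsilon;R_1^*,R_2^*)$ be the set of all $(L_1,L_2)\in\mathbb R^2$ for which there is a sequence of $(M_{1n},M_{2n},\varepsilon_n)$-codes for $(X_1^n,X_2^n)$ with $$\limsup_{n\to\infty}\varepsilon_n\le\varepsilon,\qquad \limsup_{n\to\infty}\frac1{\sqrt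 n}\big(\log M_{jn}-nR_j^*\big)\le L_j\quad(j=1,2).$$ Let $\mathbf V$ be the $3\times3$ covariance matrix of the random vector $$\Big(\log\tfrac1{P_{X_1|X_2}(X_1|X_2)},\ \log\tfrac1{P_{X_2|X_1}(X_2|X_1)},\ \log\tfrac1{P_{X_1X_2}(X_1,X_2)}\Big),$$ let $V(X_1|X_2),V(X_2|X_1),V(X_1,X_2)$ be its diagonal entries in this order, and let $\mathbf V_{1,12}$ (resp. $\mathbf V_{2,12}$) be its $2\times2$ submatrix on the indices $1,3$ (resp. $2,3$). Let $\Phi$ be the standard Gaussian cdf, let $\Phi^{-1}(p)=\sup\{y\in\mathbb R:\Phi(y)\le p\}\in[-\infty,\infty]$, and let $\Psi(t_1,t_2;\boldsymbol\mu,\boldsymbol\Sigma)=\Pr(Z_1\le t_1,\,Z_2\le t_2)$ for $(Z_1,Z_2)\sim\mathcal N(\boldsymbol\mu,\boldsymbol\Sigma)$. **Theorem.** Assume that $\mathbf V$ is positive definite. Then for every real $\varepsilon$ (the case of interest being $0<\varepsilon<1$): 1. (vertical boundary) If $R_1^*=H(X_1|X_2)$ and $R_2^*>H(X_2)$, then $\mathcal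 L(\varepsilon;R_1^*,R_2^*)=\{(L_1,L_2):L_1\ge\sqrt{V(X_1|X_2)}\,\Phi^{-1}(1-\varepsilon)\}$. 2. (diagonal face) If $R_1^*+R_2^*=H(X_1,X_2)$ and $H(X_1|X_2)<R_1^*<H(X_1)$, then $\mathcal L(\varepsilon;R_1^*,R_2^*)=\{(L_1,L_2):L_1+L_2\ge\sqrt{V(X_1,X_2)}\,\Phi^{-1}(1-\varepsilon)\}$. 3. (top-left corner point) If $R_1^*=H(X_1|X_2)$ and $R_2^*=H(X_2)$, then $\mathcal L(\varepsilon;R_1^*,R_2^*)=\{(L_1,L_2):\Psi(L_1,L_1+L_2;\mathbf 0,\mathbf V_{1,12})\ge1-\varepsilon\}$. 4. (horizontal boundary) If $R_2^*=H(X_2|X_1)$ and $R_1^*>H(X_1)$, then $\mathcal L(\varepsilon;R_1^*,R_2^*)=\{(L_1,L_2):L_2\ge\sqrt{V(X_2|X_1)}\,\Phi^{-1}(1-\varepsilon)\}$. 5. (bottom-right corner point) If $R_2^*=H(X_2|X_1)$ and $R_1^*=H(X_1)$, then $\mathcal L(\varepsilon;R_1^*,R_2^*)=\{(L_1,L_2):\Psi(L_2,L_1+L_2;\mathbf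 0,\mathbf V_{2,12})\ge1-\varepsilon\}$. -/

import Mathlib

open Filter MeasureTheory ProbabilityTheory

noncomputable section

namespace SlepianWolf

/-! ### Information quantities of a pair of finite random variables

A joint probability mass function of `(X₁, X₂)` on the finite alphabet `𝒳₁ × 𝒳₂` is a function
`P : 𝒳₁ × 𝒳₂ → ℝ` lying in `stdSimplex ℝ (𝒳₁ × 𝒳₂)`. All logarithms are to the base `2`. -/

section Source

variable {𝒳₁ 𝒳₂ : Type*} [Fintype 𝒳₁] [Fintype 𝒳₂]

/-- The marginal law `P_{X₁}`. -/
def marg₁ (P : 𝒳₁ × 𝒳₂ → ℝ) (a : 𝒳₁) : ℝ := ∑ b, P (a, b)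

/-- The marginal law `P_{X₂}`. -/
def marg₂ (P : 𝒳₁ × 𝒳₂ → ℝ) (b : 𝒳₂) : ℝ := ∑ a, P (a, b)

/-- The conditional law `P_{X₁|X₂}(x₁|x₂)` (only used where `P x > 0`). -/
def cond₁ (P : 𝒳₁ × 𝒳₂ → ℝ) (x : 𝒳₁ × 𝒳₂) : ℝ := P x / marg₂ P x.2

/-- The conditional law `P_{X₂|X₁}(x₂|x₁)` (only used where `P x > 0`). -/
def cond₂ (P : 𝒳₁ × 𝒳₂ → ℝ) (x : 𝒳₁ × 𝒳₂) : ℝ := P x / marg₁ P x.1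

/-- Shannon entropy `H(Q) = - ∑ Q(a) log₂ Q(a)`, with `0 log 0 = 0`. Applied to the joint law it is
the joint entropy `H(X₁, X₂)`. -/
def entropy {A : Type*} [Fintype A] (Q : A → ℝ) : ℝ := -∑ a, Q a * Real.logb 2 (Q a)

/-- Conditional entropy `H(X₁|X₂)`. -/
def condEntropy₁ (P : 𝒳₁ × 𝒳₂ → ℝ) : ℝ := -∑ x, P x * Real.logb 2 (cond₁ P x)

/-- Conditional entropy `H(X₂|X₁)`. -/
def condEntropy₂ (P : 𝒳₁ × 𝒳₂ → ℝ) : ℝ := -∑ x, P x * Real.logb 2 (cond₂ P x)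

/-- The entropy density vector
`(log 1/P_{X₁|X₂}(x₁|x₂), log 1/P_{X₂|X₁}(x₂|x₁), log 1/P_{X₁X₂}(x₁,x₂))`. -/
def entropyDensity (P : 𝒳₁ × 𝒳₂ → ℝ) (x : 𝒳₁ × 𝒳₂) : Fin 3 → ℝ :=
  ![Real.logb 2 (1 / cond₁ P x), Real.logb 2 (1 / cond₂ P x), Real.logb 2 (1 / P x)]

/-- Expectation of `g(X₁, X₂)` under the law `P`. -/
def expect (P g : 𝒳₁ × 𝒳₂ → ℝ) : ℝ := ∑ x, P x * g x

/-- The source dispersion matrix: the covariance matrix of the entropy density vector. Its diagonal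
entries (indices `0, 1, 2`) are `V(X₁|X₂)`, `V(X₂|X₁)` and `V(X₁, X₂)`. -/
def dispersion (P : 𝒳₁ × 𝒳₂ → ℝ) : Matrix (Fin 3) (Fin 3) ℝ :=
  Matrix.of fun i j =>
    expect P fun x =>
      (entropyDensity P x i - expect P fun y => entropyDensity P y i) *
        (entropyDensity P x j - expect P fun y => entropyDensity P y j)

/-- `V_{1,12}`: the submatrix of the dispersion matrix on its first and third indices. -/
def dispersion₁ (P : 𝒳₁ × 𝒳₂ → ℝ) : Matrix (Fin 2) (Fin 2) ℝ :=
  (dispersion P).submatrix ![0, 2] ![0, 2]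

/-- `V_{2,12}`: the submatrix of the dispersion matrix on its second and third indices. -/
def dispersion₂ (P : 𝒳₁ × 𝒳₂ → ℝ) : Matrix (Fin 2) (Fin 2) ℝ :=
  (dispersion P).submatrix ![1, 2] ![1, 2]

/-- The law of `(X₁ⁿ, X₂ⁿ)` for the discrete memoryless multiple source with one-letter law `P`. -/
def iidLaw (P : 𝒳₁ × 𝒳₂ → ℝ) (n : ℕ) (x : (Fin n → 𝒳₁) × (Fin n → 𝒳₂)) : ℝ :=
  ∏ i, P (x.1 i, x.2 i)

end Source

/-! ### Gaussian distribution functions -/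

/-- `Φ⁻¹(p) = sup {y ∈ ℝ : Φ(y) ≤ p}`, an extended real number, where `Φ` is the standard Gaussian
cdf. It is the usual inverse of `Φ` on `(0,1)`, and it is `⊥` for `p ≤ 0` and `⊤` for `p ≥ 1`. -/
def gaussianQuantile (p : ℝ) : EReal :=
  sSup ((fun y : ℝ => (y : EReal)) '' {y : ℝ | cdf (gaussianReal 0 1) y ≤ p})

/-- The bivariate Gaussian cdf `Ψ(t₁, t₂; μ, Σ)`: the probability that a Gaussian vector with mean
`μ` and covariance matrix `S` lies in `(-∞, t₁] × (-∞, t₂]`. -/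
def bivariateGaussianCDF (t₁ t₂ : ℝ) (μ : EuclideanSpace ℝ (Fin 2))
    (S : Matrix (Fin 2) (Fin 2) ℝ) : ℝ :=
  (multivariateGaussian μ S).real {x | x 0 ≤ t₁ ∧ x 1 ≤ t₂}

/-! ### Codes and the second-order coding rate region -/

/-- The maps of a distributed source code of sizes `M₁, M₂` for a pair of alphabets: two separate
encoders and a joint decoder. -/
structure Code (A₁ A₂ : Type*) (M₁ M₂ : ℕ) where
  enc₁ : A₁ → Fin M₁
  enc₂ : A₂ → Fin M₂
  dec : Fin M₁ × Fin M₂ → A₁ × A₂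

open Classical in
/-- The probability, under the joint law `Q`, that the decoder output differs from the source
pair. -/
def Code.errorProb {A₁ A₂ : Type*} [Fintype A₁] [Fintype A₂] {M₁ M₂ : ℕ}
    (c : Code A₁ A₂ M₁ M₂) (Q : A₁ × A₂ → ℝ) : ℝ :=
  ∑ x with c.dec (c.enc₁ x.1, c.enc₂ x.2) ≠ x, Q x

/-- The second-order coding rate region `ℒ(ε; R₁, R₂)` of the memoryless source with one-letter law
`P`: the pairs `(L₁, L₂)` for which there are `(M₁ₙ, M₂ₙ, εₙ)`-codes for `(X₁ⁿ, X₂ⁿ)` with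
`limsup εₙ ≤ ε` and `limsup (log₂ Mⱼₙ - n Rⱼ) / √n ≤ Lⱼ` for `j = 1, 2`. The upper limits are taken
in the extended reals. -/
def secondOrderRegion {𝒳₁ 𝒳₂ : Type*} [Fintype 𝒳₁] [Fintype 𝒳₂] (P : 𝒳₁ × 𝒳₂ → ℝ)
    (ε R₁ R₂ : ℝ) : Set (ℝ × ℝ) :=
  {L | ∃ (M₁ M₂ : ℕ → ℕ) (e : ℕ → ℝ)
      (c : ∀ n, Code (Fin n → 𝒳₁) (Fin n → 𝒳₂) (M₁ n) (M₂ n)),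
    (∀ n, (c n).errorProb (iidLaw P n) ≤ e n) ∧
    limsup (fun n => (e n : EReal)) atTop ≤ (ε : EReal) ∧
    limsup (fun n : ℕ =>
      (((Real.logb 2 (M₁ n) - n * R₁) / √(n : ℝ) : ℝ) : EReal)) atTop ≤ (L.1 : EReal) ∧
    limsup (fun n : ℕ =>
      (((Real.logb 2 (M₂ n) - n * R₂) / √(n : ℝ) : ℝ) : EReal)) atTop ≤ (L.2 : EReal)}

end SlepianWolf

end

open SlepianWolf

/-! A code is good exactly when, up to small slack, three entropy densities stay below the coding
rates: `log 1/P(x₁|x₂)` below `log M₁`, `log 1/P(x₂|x₁)` below `log M₂`, and `log 1/P(x₁,x₂)` below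
`log M₁ + log M₂`. Both directions are one-shot and cost only an additive `3θ` in probability.
Random binning gives achievability (`exists_code_errorProb_le_likelySet`), and counting the
correctly decoded pairs gives the converse (`one_sub_errorProb_le_likelySet`).

For a memoryless source the densities are i.i.d. sums (`sum_likelySet_iidLaw`), compared with
thresholds `n R + √n L`. On the scale `√n`, a constraint whose first-order rate equals the mean
stays active and contributes a Gaussian coordinate; one whose rate exceeds the mean is eventually
free. The vector central limit theorem therefore gives the Gaussian probability of an orthant in the
active coordinates (`tendsto_sum_le_thresholds`). Since the slack in `log M_j` is negligible against
`√n` or can be sent to zero afterwards, this yields `mem_secondOrderRegion_iff`.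

The five cases are the active sets `{0}`, `{2}`, `{0, 2}`, `{1}`, `{1, 2}`. Chain rules and strictly
positive mutual information show that the other constraints are strict; Gaussian marginals turn the
orthant probability into `Φ` or `Ψ`. -/

namespace SlepianWolf

/-! ### One-shot coding bounds -/

section OneShot

lemma marg₁_nonneg {A₁ A₂ : Type*} [Fintype A₂] {Q : A₁ × A₂ → ℝ} (hQ : ∀ x, 0 ≤ Q x) (a : A₁) : 0 ≤ marg₁ Q a :=
  Finset.sum_nonneg fun _ _ => hQ _

lemma marg₂_nonneg {A₁ A₂ : Type*} [Fintype A₁] {Q : A₁ × A₂ → ℝ} (hQ : ∀ x, 0 ≤ Q x) (b : A₂) : 0 ≤ marg₂ Q b :=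
  Finset.sum_nonneg fun _ _ => hQ _

lemma le_marg₁ {A₁ A₂ : Type*} [Fintype A₂] {Q : A₁ × A₂ → ℝ}
    (hQ : ∀ x, 0 ≤ Q x) (x : A₁ × A₂) : Q x ≤ marg₁ Q x.1 :=
  Finset.single_le_sum (f := fun b => Q (x.1, b)) (fun _ _ => hQ _) (Finset.mem_univ x.2)

lemma le_marg₂ {A₁ A₂ : Type*} [Fintype A₁] {Q : A₁ × A₂ → ℝ}
    (hQ : ∀ x, 0 ≤ Q x) (x : A₁ × A₂) : Q x ≤ marg₂ Q x.2 :=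
  Finset.single_le_sum (f := fun a => Q (a, x.2)) (fun _ _ => hQ _) (Finset.mem_univ x.1)

variable {A₁ A₂ : Type*} [Fintype A₁] [Fintype A₂]

open Classical in
/-- The pairs whose conditional probabilities and joint probability are at least `1 / a`, `1 / b`
and `1 / c`. -/
noncomputable def likelySet (Q : A₁ × A₂ → ℝ) (a b c : ℝ) : Finset (A₁ × A₂) :=
  {x | marg₂ Q x.2 ≤ a * Q x ∧ marg₁ Q x.1 ≤ b * Q x ∧ 1 ≤ c * Q x}

lemma sum_marg₁ (Q : A₁ × A₂ → ℝ) : ∑ a, marg₁ Q a = ∑ x, Q x := by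
  simp only [marg₁, Fintype.sum_prod_type]

lemma sum_marg₂ (Q : A₁ × A₂ → ℝ) : ∑ b, marg₂ Q b = ∑ x, Q x := by
  simp only [marg₂, Fintype.sum_prod_type_right]

open Classical in
lemma sum_slice₂_le {Q : A₁ × A₂ → ℝ} (hQ : ∀ x, 0 ≤ Q x) (T : Finset (A₁ × A₂)) (b : A₂) :
    ∑ x ∈ T with x.2 = b, Q x ≤ marg₂ Q b := by
  calc ∑ x ∈ T with x.2 = b, Q x ≤ ∑ x with x.2 = b, Q x :=
        Finset.sum_le_sum_of_subset_of_nonneg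
          (Finset.filter_subset_filter _ (Finset.subset_univ _)) fun _ _ _ => hQ _
    _ = marg₂ Q b := by
        rw [Finset.sum_filter, Fintype.sum_prod_type, marg₂]
        simp

open Classical in
lemma sum_slice₁_le {Q : A₁ × A₂ → ℝ} (hQ : ∀ x, 0 ≤ Q x) (T : Finset (A₁ × A₂)) (a : A₁) :
    ∑ x ∈ T with x.1 = a, Q x ≤ marg₁ Q a := by
  calc ∑ x ∈ T with x.1 = a, Q x ≤ ∑ x with x.1 = a, Q x :=
        Finset.sum_le_sum_of_subset_of_nonneg
          (Finset.filter_subset_filter _ (Finset.subset_univ _)) fun _ _ _ => hQ _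
    _ = marg₁ Q a := by
        rw [Finset.sum_filter, Fintype.sum_prod_type_right, marg₁]
        simp

/-- The joint condition `1 ≤ c * Q x` is what excludes points of mass zero. -/
lemma pos_of_mem_likelySet {Q : A₁ × A₂ → ℝ} (hQ : ∀ x, 0 ≤ Q x) {a b c : ℝ} {x : A₁ × A₂}
    (hx : x ∈ likelySet Q a b c) : 0 < Q x := by
  simp only [likelySet, Finset.mem_filter] at hx
  rcases (hQ x).lt_or_eq with h | h
  · exact h
  · have := hx.2.2.2
    rw [← h, mul_zero] at this
    linarith

/-- If `w > 0` on a set where `s ≤ K w` and the total weight is at most `s`, then the set has at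
most `K` elements. -/
lemma card_le_of_le_mul {A : Type*} (T : Finset A) (w : A → ℝ) (s K : ℝ) (hK : 0 ≤ K)
    (hpos : ∀ x ∈ T, 0 < w x) (hw : ∀ x ∈ T, s ≤ K * w x) (hs : ∑ x ∈ T, w x ≤ s) :
    (T.card : ℝ) ≤ K := by
  rcases T.eq_empty_or_nonempty with rfl | hT
  · simpa using hK
  have hs0 : 0 < s := (Finset.sum_pos hpos hT).trans_le hs
  have h1 : (T.card : ℝ) * s ≤ K * ∑ x ∈ T, w x := by
    rw [Finset.mul_sum, ← nsmul_eq_mul]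
    exact Finset.card_nsmul_le_sum _ _ _ hw
  have h2 : (T.card : ℝ) * s ≤ K * s := h1.trans (mul_le_mul_of_nonneg_left hs hK)
  exact le_of_mul_le_mul_right h2 hs0

open Classical in
lemma card_slice₂_likelySet_le {Q : A₁ × A₂ → ℝ} (hQ : ∀ x, 0 ≤ Q x) {a b c : ℝ} (ha : 0 ≤ a)
    (y : A₂) : (({x ∈ likelySet Q a b c | x.2 = y} : Finset _).card : ℝ) ≤ a := by
  refine card_le_of_le_mul _ Q (marg₂ Q y) a ha (fun x hx => ?_) (fun x hx => ?_)
    (sum_slice₂_le hQ _ _)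
  · exact pos_of_mem_likelySet hQ (Finset.mem_filter.1 hx).1
  · simp only [likelySet, Finset.mem_filter] at hx
    rw [← hx.2]; exact hx.1.2.1

open Classical in
lemma card_slice₁_likelySet_le {Q : A₁ × A₂ → ℝ} (hQ : ∀ x, 0 ≤ Q x) {a b c : ℝ} (hb : 0 ≤ b)
    (y : A₁) : (({x ∈ likelySet Q a b c | x.1 = y} : Finset _).card : ℝ) ≤ b := by
  refine card_le_of_le_mul _ Q (marg₁ Q y) b hb (fun x hx => ?_) (fun x hx => ?_)
    (sum_slice₁_le hQ _ _)
  · exact pos_of_mem_likelySet hQ (Finset.mem_filter.1 hx).1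
  · simp only [likelySet, Finset.mem_filter] at hx
    rw [← hx.2]; exact hx.1.2.2.1

lemma card_likelySet_le {Q : A₁ × A₂ → ℝ} (hQ : Q ∈ stdSimplex ℝ (A₁ × A₂)) {a b c : ℝ}
    (hc : 0 ≤ c) : ((likelySet Q a b c).card : ℝ) ≤ c := by
  refine card_le_of_le_mul _ Q 1 c hc (fun x hx => pos_of_mem_likelySet hQ.1 hx)
    (fun x hx => ?_) ?_
  · simp only [likelySet, Finset.mem_filter] at hx
    exact hx.2.2.2
  · rw [← hQ.2]
    exact Finset.sum_le_sum_of_subset_of_nonneg (Finset.subset_univ _) fun _ _ _ => hQ.1 _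

open Classical in
/-- A uniformly random map into `M` bins puts two given distinct points into the same bin with
probability at most `1 / M`. -/
lemma card_collision_le {A : Type*} [Fintype A] {M : ℕ} {a a' : A} (h : a ≠ a') :
    ({f : A → Fin M | f a = f a'} : Finset _).card * M ≤ Fintype.card (A → Fin M) := by
  suffices (({f : A → Fin M | f a = f a'} : Finset _) ×ˢ (Finset.univ : Finset (Fin M))).card ≤
      (Finset.univ : Finset (A → Fin M)).card by simpa [Finset.card_product] using this
  -- A colliding map can be overwritten at `a` without loss: its old value there is still visible at
  -- `a'`, while the new value records the bin.
  refine Finset.card_le_card_of_injOn (fun p => Function.update p.1 a p.2)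
    (fun _ _ => Finset.mem_coe.2 (Finset.mem_univ _)) ?_
  rintro ⟨f, i⟩ hf ⟨g, j⟩ hg hfg
  simp only [Finset.coe_product, Set.mem_prod, Finset.mem_coe, Finset.mem_filter,
    Finset.mem_univ, true_and, and_true] at hf hg hfg
  have hoff : ∀ z, z ≠ a → f z = g z := fun z hz => by
    simpa [hz] using congrFun hfg z
  have hij : i = j := by simpa using congrFun hfg a
  refine Prod.ext (funext fun z => ?_) hij
  by_cases hz : z = a
  · subst hz; exact (hf.trans (hoff _ h.symm)).trans hg.symm
  · exact hoff z hz

open Classical in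
-- Treating equal points as always colliding lets both coordinates of a pair be bounded by one
-- formula.
lemma card_collision_le_ite {A : Type*} [Fintype A] {M : ℕ} (hM : 0 < M) (a a' : A) :
    (({f : A → Fin M | f a = f a'} : Finset _).card : ℝ) ≤
      Fintype.card (A → Fin M) * (if a = a' then 1 else 1 / (M : ℝ)) := by
  split_ifs with h
  · rw [mul_one]; exact_mod_cast Finset.card_le_univ _
  · rw [mul_one_div, le_div_iff₀ (by exact_mod_cast hM)]
    exact_mod_cast card_collision_le h

open Classical in
/-- Random binning: for any set `T` there is a code whose decoder errs only outside of `T` or on a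
collision within `T`, with the collision probability bounded by its average. -/
lemma exists_code_errorProb_le {Q : A₁ × A₂ → ℝ} (hQ : Q ∈ stdSimplex ℝ (A₁ × A₂)) {M₁ M₂ : ℕ}
    (hM₁ : 0 < M₁) (hM₂ : 0 < M₂) (T : Finset (A₁ × A₂)) {K₁ K₂ K₁₂ : ℝ}
    (hK₁ : ∀ b, (({x ∈ T | x.2 = b} : Finset _).card : ℝ) ≤ K₁)
    (hK₂ : ∀ a, (({x ∈ T | x.1 = a} : Finset _).card : ℝ) ≤ K₂) (hK₁₂ : (T.card : ℝ) ≤ K₁₂) :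
    ∃ c : Code A₁ A₂ M₁ M₂, c.errorProb Q ≤
      1 - ∑ x ∈ T, Q x + (K₁ / M₁ + K₂ / M₂ + K₁₂ / (M₁ * M₂)) := by
  have : Nonempty (A₁ × A₂) := by
    by_contra h
    rw [not_nonempty_iff] at h
    simpa using hQ.2
  have : Nonempty (Fin M₁) := ⟨⟨0, hM₁⟩⟩
  have : Nonempty (Fin M₂) := ⟨⟨0, hM₂⟩⟩
  set N₁ : ℝ := (Fintype.card (A₁ → Fin M₁) : ℝ)
  set N₂ : ℝ := (Fintype.card (A₂ → Fin M₂) : ℝ)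
  have hM₁' : (0 : ℝ) < M₁ := by exact_mod_cast hM₁
  have hM₂' : (0 : ℝ) < M₂ := by exact_mod_cast hM₂
  set B : ℝ := K₁ / M₁ + K₂ / M₂ + K₁₂ / (M₁ * M₂) with hB
  let coll (f : (A₁ → Fin M₁) × (A₂ → Fin M₂)) (x y : A₁ × A₂) : ℝ :=
    if f.1 y.1 = f.1 x.1 ∧ f.2 y.2 = f.2 x.2 then 1 else 0
  have hpair (x y : A₁ × A₂) (hxy : y ≠ x) : ∑ f, coll f x y ≤
      N₁ * N₂ * ((if y.2 = x.2 then 1 / (M₁ : ℝ) else 0) + (if y.1 = x.1 then 1 / (M₂ : ℝ) else 0)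
        + 1 / (M₁ * M₂)) := by
    have h1 : ∑ f, coll f x y =
        (({f : A₁ → Fin M₁ | f y.1 = f x.1} : Finset _).card : ℝ) *
          ({f : A₂ → Fin M₂ | f y.2 = f x.2} : Finset _).card := by
      rw [Finset.sum_boole, ← Nat.cast_mul, ← Finset.card_product]
      congr 2
      ext f
      simp
    rw [h1]
    calc _ ≤ (N₁ * (if y.1 = x.1 then 1 else 1 / (M₁ : ℝ))) *
          (N₂ * (if y.2 = x.2 then 1 else 1 / (M₂ : ℝ))) := by
          gcongr
          · exact card_collision_le_ite hM₁ _ _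
          · exact card_collision_le_ite hM₂ _ _
      _ = N₁ * N₂ * ((if y.1 = x.1 then 1 else 1 / (M₁ : ℝ)) *
          (if y.2 = x.2 then 1 else 1 / (M₂ : ℝ))) := by ring
      _ ≤ _ := by
          refine mul_le_mul_of_nonneg_left ?_ (by positivity)
          -- The three terms cover agreement in the second, the first, or neither coordinate;
          -- agreement in both would give `y = x`.
          by_cases h1 : y.1 = x.1 <;> by_cases h2 : y.2 = x.2
          · exact absurd (Prod.ext h1 h2) hxy
          · simp only [h1, h2, if_true, if_false, one_mul, zero_add]
            have : (0 : ℝ) ≤ 1 / (M₁ * M₂) := by positivity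
            linarith
          · simp only [h1, h2, if_true, if_false, mul_one, add_zero]
            have : (0 : ℝ) ≤ 1 / (M₁ * M₂) := by positivity
            linarith
          · simp only [h1, h2, if_false, zero_add]
            rw [one_div_mul_one_div]
  have hpoint (x : A₁ × A₂) : ∑ f, ∑ y ∈ T with y ≠ x, coll f x y ≤ N₁ * N₂ * B := by
    rw [Finset.sum_comm]
    calc ∑ y ∈ T with y ≠ x, ∑ f, coll f x y
        ≤ ∑ y ∈ T with y ≠ x, N₁ * N₂ * ((if y.2 = x.2 then 1 / (M₁ : ℝ) else 0) +
          (if y.1 = x.1 then 1 / (M₂ : ℝ) else 0) + 1 / (M₁ * M₂)) :=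
          Finset.sum_le_sum fun y hy => hpair x y (Finset.mem_filter.1 hy).2
      _ ≤ ∑ y ∈ T, N₁ * N₂ * ((if y.2 = x.2 then 1 / (M₁ : ℝ) else 0) +
          (if y.1 = x.1 then 1 / (M₂ : ℝ) else 0) + 1 / (M₁ * M₂)) := by
          refine Finset.sum_le_sum_of_subset_of_nonneg (Finset.filter_subset _ _) fun _ _ _ => ?_
          refine mul_nonneg (by positivity) (add_nonneg (add_nonneg ?_ ?_) (by positivity)) <;>
            split_ifs <;> positivity
      _ ≤ N₁ * N₂ * B := by
          rw [← Finset.mul_sum]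
          refine mul_le_mul_of_nonneg_left ?_ (by positivity)
          rw [Finset.sum_add_distrib, Finset.sum_add_distrib, ← Finset.sum_filter,
            ← Finset.sum_filter]
          simp only [Finset.sum_const, nsmul_eq_mul, mul_one_div]
          rw [hB]
          gcongr
          · exact hK₁ _
          · exact hK₂ _
  -- Some pair of binning maps does no worse than the average over all pairs.
  obtain ⟨f, -, hf⟩ : ∃ f ∈ (Finset.univ : Finset ((A₁ → Fin M₁) × (A₂ → Fin M₂))),
      ∑ x, Q x * ∑ y ∈ T with y ≠ x, coll f x y ≤ B := by
    refine Finset.exists_le_of_sum_le Finset.univ_nonempty ?_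
    rw [Finset.sum_comm]
    calc ∑ x, ∑ f, Q x * ∑ y ∈ T with y ≠ x, coll f x y
        = ∑ x, Q x * ∑ f, ∑ y ∈ T with y ≠ x, coll f x y := by simp only [Finset.mul_sum]
      _ ≤ ∑ x, Q x * (N₁ * N₂ * B) :=
          Finset.sum_le_sum fun x _ => mul_le_mul_of_nonneg_left (hpoint x) (hQ.1 x)
      _ = ∑ _f : (A₁ → Fin M₁) × (A₂ → Fin M₂), B := by
          rw [← Finset.sum_mul, hQ.2, one_mul, Finset.sum_const, nsmul_eq_mul, Finset.card_univ,
            Fintype.card_prod, Nat.cast_mul]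
  -- The decoder returns any member of `T` in the received bins; the arbitrary value is used only
  -- when there is none.
  let dec (p : Fin M₁ × Fin M₂) : A₁ × A₂ :=
    if h : ∃ y ∈ T, f.1 y.1 = p.1 ∧ f.2 y.2 = p.2 then h.choose else Classical.arbitrary _
  refine ⟨⟨f.1, f.2, dec⟩, ?_⟩
  have herr (x : A₁ × A₂) (hx : dec (f.1 x.1, f.2 x.2) ≠ x) :
      Q x ≤ (if x ∈ T then 0 else Q x) + Q x * ∑ y ∈ T with y ≠ x, coll f x y := by
    have hcoll : 0 ≤ ∑ y ∈ T with y ≠ x, coll f x y := Finset.sum_nonneg fun y _ => by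
      simp only [coll]; split_ifs <;> norm_num
    by_cases hxT : x ∈ T
    · have hex : ∃ y ∈ T, f.1 y.1 = (f.1 x.1, f.2 x.2).1 ∧ f.2 y.2 = (f.1 x.1, f.2 x.2).2 :=
        ⟨x, hxT, rfl, rfl⟩
      have hdec : dec (f.1 x.1, f.2 x.2) = hex.choose := dif_pos hex
      have hspec := hex.choose_spec
      rw [← hdec] at hspec
      have h1 : (1 : ℝ) ≤ ∑ y ∈ T with y ≠ x, coll f x y := by
        refine le_trans (le_of_eq ?_) (Finset.single_le_sum (f := coll f x) (fun y _ => ?_)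
          (Finset.mem_filter.2 ⟨hspec.1, hx⟩))
        · exact (if_pos hspec.2).symm
        · simp only [coll]; split_ifs <;> norm_num
      rw [if_pos hxT, zero_add]
      exact le_mul_of_one_le_right (hQ.1 x) h1
    · rw [if_neg hxT]
      exact le_add_of_nonneg_right (mul_nonneg (hQ.1 x) hcoll)
  have hnn (x : A₁ × A₂) :
      0 ≤ (if x ∈ T then 0 else Q x) + Q x * ∑ y ∈ T with y ≠ x, coll f x y := by
    refine add_nonneg (by split_ifs; exacts [le_rfl, hQ.1 x]) (mul_nonneg (hQ.1 x)
      (Finset.sum_nonneg fun y _ => ?_))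
    simp only [coll]; split_ifs <;> norm_num
  calc Code.errorProb ⟨f.1, f.2, dec⟩ Q
      ≤ ∑ x with dec (f.1 x.1, f.2 x.2) ≠ x,
        ((if x ∈ T then 0 else Q x) + Q x * ∑ y ∈ T with y ≠ x, coll f x y) :=
        Finset.sum_le_sum fun x hx => herr x (Finset.mem_filter.1 hx).2
    _ ≤ ∑ x, ((if x ∈ T then 0 else Q x) + Q x * ∑ y ∈ T with y ≠ x, coll f x y) :=
        Finset.sum_le_sum_of_subset_of_nonneg (Finset.filter_subset _ _) fun x _ _ => hnn x
    _ ≤ 1 - ∑ x ∈ T, Q x + B := by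
        rw [Finset.sum_add_distrib]
        refine add_le_add (le_of_eq ?_) hf
        rw [eq_sub_iff_add_eq, ← hQ.2, ← Finset.sum_ite_mem_eq T, ← Finset.sum_add_distrib]
        exact Finset.sum_congr rfl fun x _ => by split_ifs <;> simp

/-- One-shot achievability. -/
lemma exists_code_errorProb_le_likelySet {Q : A₁ × A₂ → ℝ} (hQ : Q ∈ stdSimplex ℝ (A₁ × A₂))
    {M₁ M₂ : ℕ} (hM₁ : 0 < M₁) (hM₂ : 0 < M₂) {θ : ℝ} (hθ : 0 ≤ θ) :
    ∃ c : Code A₁ A₂ M₁ M₂, c.errorProb Q ≤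
      1 - ∑ x ∈ likelySet Q (θ * M₁) (θ * M₂) (θ * (M₁ * M₂)), Q x + 3 * θ := by
  have hM₁' : (0 : ℝ) < M₁ := by exact_mod_cast hM₁
  have hM₂' : (0 : ℝ) < M₂ := by exact_mod_cast hM₂
  obtain ⟨c, hc⟩ := exists_code_errorProb_le hQ hM₁ hM₂
    (likelySet Q (θ * M₁) (θ * M₂) (θ * (M₁ * M₂)))
    (fun b => card_slice₂_likelySet_le hQ.1 (by positivity) b)
    (fun a => card_slice₁_likelySet_le hQ.1 (by positivity) a)
    (card_likelySet_le hQ (by positivity))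
  refine ⟨c, hc.trans (le_of_eq ?_)⟩
  field_simp
  ring

/-- One-shot converse. -/
lemma one_sub_errorProb_le_likelySet {Q : A₁ × A₂ → ℝ} (hQ : Q ∈ stdSimplex ℝ (A₁ × A₂))
    {M₁ M₂ : ℕ} (hM₁ : 0 < M₁) (hM₂ : 0 < M₂) (c : Code A₁ A₂ M₁ M₂) {θ : ℝ} (hθ : 0 < θ) :
    1 - c.errorProb Q ≤ ∑ x ∈ likelySet Q (M₁ / θ) (M₂ / θ) (M₁ * M₂ / θ), Q x + 3 * θ := by
  classical
  have hM₁' : (0 : ℝ) < M₁ := by exact_mod_cast hM₁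
  have hM₂' : (0 : ℝ) < M₂ := by exact_mod_cast hM₂
  set C : Finset (A₁ × A₂) := {x | c.dec (c.enc₁ x.1, c.enc₂ x.2) = x} with hC
  set L := likelySet Q (M₁ / θ) (M₂ / θ) (M₁ * M₂ / θ) with hL
  have hCmem {x} : x ∈ C ↔ c.dec (c.enc₁ x.1, c.enc₂ x.2) = x := by simp [hC]
  have hsum : 1 - c.errorProb Q = ∑ x ∈ C, Q x := by
    rw [sub_eq_iff_eq_add, ← hQ.2, Code.errorProb, hC]
    exact (Finset.sum_filter_add_sum_filter_not _ _ _).symm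
  -- Among correctly decoded pairs with a fixed second component, the first codeword determines the
  -- pair.
  have hcard₁ (b : A₂) : ((({x ∈ C | x.2 = b} : Finset _)).card : ℝ) ≤ M₁ := by
    have : ({x ∈ C | x.2 = b} : Finset _).card ≤ (Finset.univ : Finset (Fin M₁)).card := by
      refine Finset.card_le_card_of_injOn (fun x => c.enc₁ x.1)
        (fun _ _ => Finset.mem_coe.2 (Finset.mem_univ _)) fun x hx y hy hxy => ?_
      simp only [Finset.coe_filter, Set.mem_ofPred_eq, hCmem] at hx hy hxy
      rw [← hx.1, ← hy.1, hx.2, hy.2, hxy]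
    simpa using this
  have hcard₂ (a : A₁) : ((({x ∈ C | x.1 = a} : Finset _)).card : ℝ) ≤ M₂ := by
    have : ({x ∈ C | x.1 = a} : Finset _).card ≤ (Finset.univ : Finset (Fin M₂)).card := by
      refine Finset.card_le_card_of_injOn (fun x => c.enc₂ x.2)
        (fun _ _ => Finset.mem_coe.2 (Finset.mem_univ _)) fun x hx y hy hxy => ?_
      simp only [Finset.coe_filter, Set.mem_ofPred_eq, hCmem] at hx hy hxy
      rw [← hx.1, ← hy.1, hx.2, hy.2, hxy]
    simpa using this
  have hcard : (C.card : ℝ) ≤ M₁ * M₂ := by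
    have : C.card ≤ (Finset.univ : Finset (Fin M₁ × Fin M₂)).card := by
      refine Finset.card_le_card_of_injOn (fun x => (c.enc₁ x.1, c.enc₂ x.2))
        (fun _ _ => Finset.mem_coe.2 (Finset.mem_univ _)) fun x hx y hy hxy => ?_
      rw [← hCmem.1 hx, ← hCmem.1 hy]
      exact congrArg c.dec hxy
    have h2 : (C.card : ℝ) ≤ ((M₁ * M₂ : ℕ) : ℝ) := by
      exact_mod_cast (by simpa using this)
    simpa using h2
  -- Off the likely set one of the three inequalities fails, so `Q x` lies below the corresponding
  -- term. By the counts above, each term sums over `C` to at most `θ`.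
  have hpt (x : A₁ × A₂) (_ : x ∈ C) : Q x ≤ (if x ∈ L then Q x else 0) +
      (θ / M₁ * marg₂ Q x.2 + θ / M₂ * marg₁ Q x.1 + θ / (M₁ * M₂)) := by
    have h0₁ : 0 ≤ θ / M₁ * marg₂ Q x.2 := mul_nonneg (by positivity) (marg₂_nonneg hQ.1 _)
    have h0₂ : 0 ≤ θ / M₂ * marg₁ Q x.1 := mul_nonneg (by positivity) (marg₁_nonneg hQ.1 _)
    have h0₃ : 0 ≤ θ / (M₁ * M₂) := by positivity
    split_ifs with hx
    · linarith
    · by_contra! hlt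
      apply hx
      rw [hL, likelySet, Finset.mem_filter]
      refine ⟨Finset.mem_univ _, ?_, ?_, ?_⟩
      · have : θ / M₁ * marg₂ Q x.2 ≤ Q x := by linarith
        calc marg₂ Q x.2 = M₁ / θ * (θ / M₁ * marg₂ Q x.2) := by field_simp
          _ ≤ _ := mul_le_mul_of_nonneg_left this (by positivity)
      · have : θ / M₂ * marg₁ Q x.1 ≤ Q x := by linarith
        calc marg₁ Q x.1 = M₂ / θ * (θ / M₂ * marg₁ Q x.1) := by field_simp
          _ ≤ _ := mul_le_mul_of_nonneg_left this (by positivity)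
      · have : θ / (M₁ * M₂) ≤ Q x := by linarith
        calc 1 = M₁ * M₂ / θ * (θ / (M₁ * M₂)) := by field_simp
          _ ≤ _ := mul_le_mul_of_nonneg_left this (by positivity)
  rw [hsum]
  refine (Finset.sum_le_sum hpt).trans ?_
  rw [Finset.sum_add_distrib]
  refine add_le_add ?_ ?_
  · rw [← Finset.sum_ite_mem_eq L]
    refine Finset.sum_le_sum_of_subset_of_nonneg (Finset.subset_univ _) fun x _ _ => ?_
    split_ifs
    exacts [hQ.1 x, le_rfl]
  · rw [Finset.sum_add_distrib, Finset.sum_add_distrib]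
    have h1 : ∑ x ∈ C, θ / M₁ * marg₂ Q x.2 ≤ θ := by
      rw [← Finset.sum_fiberwise C (fun x => x.2)]
      calc ∑ b, ∑ x ∈ C with x.2 = b, θ / M₁ * marg₂ Q x.2
          = ∑ b, (({x ∈ C | x.2 = b} : Finset _).card : ℝ) * (θ / M₁ * marg₂ Q b) := by
            refine Finset.sum_congr rfl fun b _ => ?_
            rw [← nsmul_eq_mul, ← Finset.sum_const]
            exact Finset.sum_congr rfl fun x hx => by rw [(Finset.mem_filter.1 hx).2]
        _ ≤ ∑ b, (M₁ : ℝ) * (θ / M₁ * marg₂ Q b) :=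
            Finset.sum_le_sum fun b _ => mul_le_mul_of_nonneg_right (hcard₁ b)
              (mul_nonneg (by positivity) (marg₂_nonneg hQ.1 _))
        _ = ∑ b, θ * marg₂ Q b := Finset.sum_congr rfl fun b _ => by field_simp
        _ = θ := by rw [← Finset.mul_sum, sum_marg₂, hQ.2, mul_one]
    have h2 : ∑ x ∈ C, θ / M₂ * marg₁ Q x.1 ≤ θ := by
      rw [← Finset.sum_fiberwise C (fun x => x.1)]
      calc ∑ a, ∑ x ∈ C with x.1 = a, θ / M₂ * marg₁ Q x.1
          = ∑ a, (({x ∈ C | x.1 = a} : Finset _).card : ℝ) * (θ / M₂ * marg₁ Q a) := by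
            refine Finset.sum_congr rfl fun b _ => ?_
            rw [← nsmul_eq_mul, ← Finset.sum_const]
            exact Finset.sum_congr rfl fun x hx => by rw [(Finset.mem_filter.1 hx).2]
        _ ≤ ∑ a, (M₂ : ℝ) * (θ / M₂ * marg₁ Q a) :=
            Finset.sum_le_sum fun b _ => mul_le_mul_of_nonneg_right (hcard₂ b)
              (mul_nonneg (by positivity) (marg₁_nonneg hQ.1 _))
        _ = ∑ a, θ * marg₁ Q a := Finset.sum_congr rfl fun b _ => by field_simp
        _ = θ := by rw [← Finset.mul_sum, sum_marg₁, hQ.2, mul_one]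
    have h3 : ∑ x ∈ C, θ / ((M₁ : ℝ) * M₂) ≤ θ := by
      rw [Finset.sum_const, nsmul_eq_mul]
      calc (C.card : ℝ) * (θ / (M₁ * M₂)) ≤ (M₁ * M₂) * (θ / (M₁ * M₂)) :=
            mul_le_mul_of_nonneg_right hcard (by positivity)
        _ = θ := by field_simp
    linarith

end OneShot

/-! ### Vector central limit theorem for a memoryless source -/

section CentralLimit

open scoped Topology RealInnerProductSpace Matrix

variable {A : Type*} [Fintype A] [MeasurableSpace A]

/-- The measure on a finite alphabet with point masses `P`. -/
noncomputable def massMeasure (P : A → ℝ) : Measure A :=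
  ∑ a, ENNReal.ofReal (P a) • Measure.dirac a

lemma isProbabilityMeasure_massMeasure {P : A → ℝ} (hP : P ∈ stdSimplex ℝ A) :
    IsProbabilityMeasure (massMeasure P) := by
  constructor
  simp [massMeasure, Measure.finsetSum_apply]
  rw [← ENNReal.ofReal_sum_of_nonneg fun _ _ => hP.1 _, hP.2, ENNReal.ofReal_one]

/-- The law of the memoryless source as a measure on infinite sequences. -/
noncomputable def sourceMeasure (P : A → ℝ) : Measure (ℕ → A) :=
  Measure.infinitePi fun _ => massMeasure P

lemma isProbabilityMeasure_sourceMeasure {P : A → ℝ} (hP : P ∈ stdSimplex ℝ A) :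
    IsProbabilityMeasure (sourceMeasure P) := by
  have := isProbabilityMeasure_massMeasure hP
  unfold sourceMeasure
  infer_instance

variable [MeasurableSingletonClass A]

lemma massMeasure_singleton (P : A → ℝ) (a : A) :
    massMeasure P {a} = ENNReal.ofReal (P a) := by
  classical
  simp only [massMeasure, Measure.finsetSum_apply, Measure.smul_apply, smul_eq_mul,
    Measure.dirac_apply' _ (MeasurableSet.singleton _), Set.indicator_apply,
    Set.mem_singleton_iff, Pi.one_apply, mul_ite, mul_one, mul_zero, Finset.sum_ite_eq',
    Finset.mem_univ, if_true]

lemma integral_massMeasure {P : A → ℝ} (hP : P ∈ stdSimplex ℝ A) (f : A → ℝ) :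
    ∫ a, f a ∂(massMeasure P) = ∑ a, P a * f a := by
  have := isProbabilityMeasure_massMeasure hP
  rw [integral_fintype .of_finite]
  refine Finset.sum_congr rfl fun a _ => ?_
  rw [smul_eq_mul, Measure.real, massMeasure_singleton, ENNReal.toReal_ofReal (hP.1 a)]

/-- Transfers finite sums over words of length `n` to one probability space carrying all `n`, where
the central limit theorem applies. -/
lemma sourceMeasure_real_preimage {P : A → ℝ} (hP : P ∈ stdSimplex ℝ A) (n : ℕ)
    (p : (Fin n → A) → Prop) [DecidablePred p] :
    (sourceMeasure P).real {ω | p fun i => ω i} = ∑ x with p x, ∏ i, P (x i) := by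
  have := isProbabilityMeasure_massMeasure hP
  have := isProbabilityMeasure_sourceMeasure hP
  have hind : iIndepFun (fun (i : ℕ) (ω : ℕ → A) => ω i) (sourceMeasure P) :=
    iIndepFun_infinitePi (X := fun _ a => a) fun _ => measurable_id
  have hmap : (sourceMeasure P).map (fun ω (i : Fin n) => ω i) =
      Measure.pi fun _ => massMeasure P := by
    rw [(hind.precomp (Fin.val_injective (n := n))).map_fun_eq_pi_map
      fun i => (measurable_pi_apply _).aemeasurable]
    congr 1
    funext i
    exact Measure.infinitePi_map_eval _ _
  have hmeas : Measurable fun (ω : ℕ → A) (i : Fin n) => ω i := by fun_prop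
  have hset : {ω : ℕ → A | p fun i => ω i} = (fun ω (i : Fin n) => ω i) ⁻¹'
      (({x | p x} : Finset (Fin n → A)) : Set (Fin n → A)) := by
    ext ω; simp
  rw [hset, Measure.real, ← Measure.map_apply hmeas (Finset.measurableSet _), hmap, ← Measure.real,
    ← sum_measureReal_singleton]
  refine Finset.sum_congr rfl fun x _ => ?_
  rw [Measure.real, Measure.pi_singleton, ENNReal.toReal_prod]
  refine Finset.prod_congr rfl fun i _ => ?_
  rw [massMeasure_singleton, ENNReal.toReal_ofReal (hP.1 _)]

/-- The centred and normalised sum of the first `n` values of `h`. -/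
noncomputable def normalizedSum {ι : Type*} (P : A → ℝ) (h : A → ι → ℝ) (n : ℕ) (ω : ℕ → A) :
    EuclideanSpace ℝ ι :=
  WithLp.toLp 2 fun k => (√(n : ℝ))⁻¹ * (∑ i ∈ Finset.range n, h (ω i) k - n * ∑ a, P a * h a k)

lemma measurable_normalizedSum {ι : Type*} [Fintype ι] (P : A → ℝ) (h : A → ι → ℝ) (n : ℕ) :
    Measurable (normalizedSum P h n) := by
  have (k : ι) : Measurable fun a => h a k := measurable_of_finite _
  unfold normalizedSum
  fun_prop

/-- The central limit theorem for vector-valued functions of a memoryless source. -/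
lemma tendsto_map_normalizedSum {ι : Type*} [Fintype ι] [DecidableEq ι] {P : A → ℝ}
    (hP : P ∈ stdSimplex ℝ A) (h : A → ι → ℝ) {S : Matrix ι ι ℝ} (hS : S.PosSemidef)
    (hSeq : ∀ j k, S j k =
      ∑ a, P a * ((h a j - ∑ b, P b * h b j) * (h a k - ∑ b, P b * h b k)))
    (μs : ℕ → ProbabilityMeasure (EuclideanSpace ℝ ι))
    (hμs : ∀ n, (μs n : Measure _) = (sourceMeasure P).map (normalizedSum P h n))
    (μ : ProbabilityMeasure (EuclideanSpace ℝ ι))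
    (hμ : (μ : Measure _) = multivariateGaussian 0 S) :
    Tendsto μs atTop (𝓝 μ) := by
  have := isProbabilityMeasure_massMeasure hP
  have := isProbabilityMeasure_sourceMeasure hP
  -- Cramér–Wold: the characteristic function at `t` is that of the scalar projection on `t` at `1`,
  -- so the scalar theorem applied to `g` suffices.
  refine ProbabilityMeasure.tendsto_of_tendsto_charFun fun t => ?_
  let g (a : A) : ℝ := ∑ k, t k * h a k
  have hg : Measurable g := measurable_of_finite _
  let X (i : ℕ) (ω : ℕ → A) : ℝ := g (ω i)
  have hX (i : ℕ) : Measurable (X i) := hg.comp (measurable_pi_apply i)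
  have hcoord (i : ℕ) : IdentDistrib (fun ω : ℕ → A => ω i) (fun ω => ω 0) (sourceMeasure P)
      (sourceMeasure P) := by
    refine ⟨(measurable_pi_apply i).aemeasurable, (measurable_pi_apply 0).aemeasurable, ?_⟩
    rw [sourceMeasure, Measure.infinitePi_map_eval, Measure.infinitePi_map_eval]
  have hid (i : ℕ) : IdentDistrib (X i) (X 0) (sourceMeasure P) (sourceMeasure P) :=
    (hcoord i).comp hg
  have hind : iIndepFun X (sourceMeasure P) :=
    iIndepFun_infinitePi (X := fun _ => g) fun _ => hg
  have hL2 : MemLp (X 0) 2 (sourceMeasure P) := by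
    obtain ⟨C, hC⟩ := (Set.finite_range fun a => ‖g a‖).bddAbove
    exact .of_bound (hX 0).aestronglyMeasurable C
      (.of_forall fun ω => hC (Set.mem_range_self (ω 0)))
  have hint (f : A → ℝ) : ∫ ω, f (ω 0) ∂(sourceMeasure P) = ∑ a, P a * f a := by
    rw [← integral_massMeasure hP, ← Measure.infinitePi_map_eval (fun _ : ℕ => massMeasure P) 0,
      integral_map (measurable_pi_apply 0).aemeasurable
        (measurable_of_finite f).aestronglyMeasurable, sourceMeasure]
  have hmean : (sourceMeasure P)[X 0] = ∑ a, P a * g a := hint g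
  have hvar : Var[X 0; sourceMeasure P] = t ⬝ᵥ S *ᵥ t := by
    rw [variance_eq_integral (hX 0).aemeasurable, hmean]
    refine (hint fun a => (g a - ∑ b, P b * g b) ^ 2).trans ?_
    have hcen (a : A) : g a - ∑ b, P b * g b = ∑ k, t k * (h a k - ∑ b, P b * h b k) := by
      simp only [g, Finset.mul_sum, mul_sub, Finset.sum_sub_distrib]
      congr 1
      rw [Finset.sum_comm]
      exact Finset.sum_congr rfl fun k _ => Finset.sum_congr rfl fun b _ => by ring
    simp only [hcen, sq, dotProduct, Matrix.mulVec, hSeq, Finset.mul_sum,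
      Finset.sum_mul]
    rw [Finset.sum_comm]
    refine Finset.sum_congr rfl fun j _ => ?_
    rw [Finset.sum_comm]
    exact Finset.sum_congr rfl fun k _ => Finset.sum_congr rfl fun b _ => by ring
  have hclt := (tendstoInDistribution_inv_sqrt_mul_sum_sub (Y := id) (X := X)
    (P := sourceMeasure P) (P' := gaussianReal 0 Var[X 0; sourceMeasure P].toNNReal)
    HasLaw.id hL2 hind hid).tendsto
  have h1 := ProbabilityMeasure.tendsto_iff_tendsto_charFun.1 hclt 1
  have hinner (n : ℕ) (ω : ℕ → A) : ⟪normalizedSum P h n ω, t⟫ =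
      (√(n : ℝ))⁻¹ * (∑ i ∈ Finset.range n, X i ω - n * ∑ a, P a * g a) := by
    simp only [normalizedSum, PiLp.inner_apply, RCLike.inner_apply, conj_trivial, X, g]
    rw [Finset.sum_comm]
    simp only [Finset.mul_sum, mul_sub, Finset.sum_sub_distrib]
    congr 1
    · exact Finset.sum_congr rfl fun k _ => Finset.sum_congr rfl fun b _ => by ring
    · rw [Finset.sum_comm]
      exact Finset.sum_congr rfl fun k _ => Finset.sum_congr rfl fun b _ => by ring
  convert h1 using 2 with n
  · rw [hμs, charFun_apply, charFun_apply,
      integral_map (measurable_normalizedSum P h n).aemeasurable (by fun_prop)]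
    refine Eq.trans ?_ (integral_map (μ := sourceMeasure P)
      (by fun_prop) (by fun_prop)).symm
    simp only [hinner, hmean]
    simp
  · rw [hμ, charFun_multivariateGaussian hS]
    refine Eq.trans ?_ (congrArg (fun ν => charFun ν (1 : ℝ)) Measure.map_id.symm)
    rw [charFun_gaussianReal, hvar]
    have : 0 ≤ t.ofLp ⬝ᵥ S *ᵥ t.ofLp := by simpa using hS.dotProduct_mulVec_nonneg t.ofLp
    simp [Real.coe_toNNReal _ this]

end CentralLimit

/-! ### Limits of orthant probabilities with active and inactive constraints -/

section Thresholds

open scoped Topology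

variable {ι : Type*}

/-- The orthant-type set on which the coordinates in `s` are bounded by `L`. -/
def lowerOrthant (s : Finset ι) (L : ι → ℝ) : Set (EuclideanSpace ℝ ι) :=
  {z | ∀ k ∈ s, z k ≤ L k}

lemma isClosed_lowerOrthant (s : Finset ι) (L : ι → ℝ) : IsClosed (lowerOrthant s L) := by
  simp only [lowerOrthant, Set.ofPred_forall]
  exact isClosed_iInter fun k => isClosed_iInter fun _ =>
    isClosed_le (by fun_prop) continuous_const

variable [Fintype ι]

/-- The probability of an orthant is right-continuous in the thresholds. -/
lemma le_lowerOrthant_of_forall_pos (μ : Measure (EuclideanSpace ℝ ι)) [IsFiniteMeasure μ]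
    (s : Finset ι) (L c : ι → ℝ) (hc : ∀ k, 0 ≤ c k) {a : ℝ}
    (h : ∀ δ : ℝ, 0 < δ → a ≤ μ.real (lowerOrthant s fun k => L k + c k * δ)) :
    a ≤ μ.real (lowerOrthant s L) := by
  let C (m : ℕ) : Set (EuclideanSpace ℝ ι) := lowerOrthant s fun k => L k + c k * (1 / (m + 1))
  have hinter : ⋂ m, C m = lowerOrthant s L := by
    ext z
    simp only [Set.mem_iInter, C, lowerOrthant]
    constructor
    · intro hz k hk
      refine ge_of_tendsto' (x := atTop) (f := fun m : ℕ => L k + c k * (1 / ((m : ℝ) + 1))) ?_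
        fun m => hz m k hk
      simpa using (tendsto_one_div_add_atTop_nhds_zero_nat (𝕜 := ℝ)).const_mul (c k)
        |>.const_add (L k)
    · intro hz m k hk
      exact (hz k hk).trans (le_add_of_nonneg_right (mul_nonneg (hc k) (by positivity)))
  have hanti : Antitone C := by
    intro m m' hm z hz k hk
    refine (hz k hk).trans ?_
    exact add_le_add_right
      (mul_le_mul_of_nonneg_left (one_div_le_one_div_of_le (by positivity) (by gcongr)) (hc k)) _
  have hlim := tendsto_measure_iInter_atTop (μ := μ)
    (fun m => (isClosed_lowerOrthant s _).measurableSet.nullMeasurableSet) hanti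
    ⟨0, measure_ne_top _ _⟩
  rw [hinter] at hlim
  exact ge_of_tendsto' ((ENNReal.tendsto_toReal (measure_ne_top _ _)).comp hlim)
    fun m => h _ (by positivity)

variable [DecidableEq ι]

lemma multivariateGaussian_hyperplane {S : Matrix ι ι ℝ} (hS : S.PosDef) (k : ι) (a : ℝ) :
    multivariateGaussian 0 S {z | z k = a} = 0 := by
  have hpos : 0 < S k k := hS.diag_pos
  have hp := measurePreserving_eval_multivariateGaussian (μ := 0) hS.posSemidef (i := k)
  have : NullSingletonClass (gaussianReal ((0 : EuclideanSpace ℝ ι) k) (S k k).toNNReal) :=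
    nullSingletonClass_gaussianReal (by simpa using hpos)
  have h := hp.measure_preimage (MeasurableSet.singleton a).nullMeasurableSet
  rw [measure_singleton] at h
  exact h

/-- The frontier lies in coordinate hyperplanes, which are null because every coordinate has
positive variance. Orthants are thus continuity sets for weak convergence. -/
lemma multivariateGaussian_frontier_lowerOrthant {S : Matrix ι ι ℝ} (hS : S.PosDef)
    (s : Finset ι) (L : ι → ℝ) :
    multivariateGaussian 0 S (frontier (lowerOrthant s L)) = 0 := by
  refine measure_mono_null (t := ⋃ k, {z : EuclideanSpace ℝ ι | z k = L k}) ?_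
    (measure_iUnion_null fun k => multivariateGaussian_hyperplane hS k _)
  intro z hz
  by_contra hne
  simp only [Set.mem_iUnion, not_exists] at hne
  rw [(isClosed_lowerOrthant s L).frontier_eq] at hz
  refine hz.2 (mem_interior.2 ⟨⋂ k ∈ s, {z : EuclideanSpace ℝ ι | z k < L k}, ?_, ?_, ?_⟩)
  · exact fun y hy k hk => le_of_lt (Set.mem_iInter₂.1 hy k hk)
  · exact isOpen_biInter_finset fun k _ => isOpen_lt (by fun_prop) continuous_const
  · exact Set.mem_iInter₂.2 fun k hk => lt_of_le_of_ne (hz.1 k hk) (hne k)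

/-- Thresholds of inactive coordinates may be sent to infinity. -/
lemma tendsto_lowerOrthant_inactive (μ : Measure (EuclideanSpace ℝ ι)) [IsFiniteMeasure μ]
    (s : Finset ι) (L : ι → ℝ) :
    Tendsto (fun c : ℕ => μ.real (lowerOrthant Finset.univ fun k => if k ∈ s then L k else c))
      atTop (𝓝 (μ.real (lowerOrthant s L))) := by
  let C (m : ℕ) : Set (EuclideanSpace ℝ ι) :=
    lowerOrthant Finset.univ fun k => if k ∈ s then L k else m
  have hunion : ⋃ m, C m = lowerOrthant s L := by
    ext z
    simp only [Set.mem_iUnion, C, lowerOrthant]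
    constructor
    · rintro ⟨m, hz⟩ k hk
      simpa [hk] using hz k (Finset.mem_univ k)
    · intro hz
      -- The sum of absolute values dominates every coordinate at once.
      obtain ⟨m, hm⟩ := exists_nat_ge (∑ k, |z k|)
      refine ⟨m, fun k _ => ?_⟩
      by_cases hk : k ∈ s
      · simpa [hk] using hz k hk
      · simp only [hk, if_false]
        exact (le_abs_self _).trans ((Finset.single_le_sum (f := fun k => |z k|)
          (fun _ _ => abs_nonneg _) (Finset.mem_univ k)).trans hm)
  have hmono : Monotone C := by
    intro m m' hm z hz k hk
    refine (hz k hk).trans ?_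
    dsimp only
    split_ifs
    · exact le_rfl
    · exact_mod_cast hm
  have hlim := tendsto_measure_iUnion_atTop (μ := μ) hmono
  rw [hunion] at hlim
  exact (ENNReal.tendsto_toReal (measure_ne_top _ _)).comp hlim

open Classical in
/-- The probability that all sums of `h` over a memoryless source stay below thresholds
`n R + √n L`, where `R` is the mean for the active coordinates and exceeds it for the others. -/
lemma tendsto_sum_le_thresholds {A : Type*} [Fintype A] {P : A → ℝ} (hP : P ∈ stdSimplex ℝ A)
    (h : A → ι → ℝ) {S : Matrix ι ι ℝ} (hS : S.PosDef)
    (hSeq : ∀ j k, S j k =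
      ∑ a, P a * ((h a j - ∑ b, P b * h b j) * (h a k - ∑ b, P b * h b k)))
    (s : Finset ι) (R L : ι → ℝ) (hR : ∀ k ∈ s, R k = ∑ a, P a * h a k)
    (hR' : ∀ k ∉ s, ∑ a, P a * h a k < R k) :
    Tendsto (fun n : ℕ => ∑ x : Fin n → A with ∀ k, ∑ i, h (x i) k ≤ n * R k + √(n : ℝ) * L k,
      ∏ i, P (x i)) atTop (𝓝 ((multivariateGaussian 0 S).real (lowerOrthant s L))) := by
  let _ : MeasurableSpace A := ⊤
  have : MeasurableSingletonClass A := ⟨fun _ => trivial⟩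
  have := isProbabilityMeasure_sourceMeasure hP
  set μ := multivariateGaussian (0 : EuclideanSpace ℝ ι) S with hμ
  let ν (n : ℕ) : Measure (EuclideanSpace ℝ ι) := (sourceMeasure P).map (normalizedSum P h n)
  have hν (n : ℕ) : IsProbabilityMeasure (ν n) :=
    Measure.isProbabilityMeasure_map (measurable_normalizedSum P h n).aemeasurable
  have hweak := tendsto_map_normalizedSum hP h hS.posSemidef hSeq (fun n => ⟨ν n, hν n⟩)
    (fun _ => rfl) ⟨μ, inferInstance⟩ rfl
  have hport (s : Finset ι) (L : ι → ℝ) :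
      Tendsto (fun n => (ν n).real (lowerOrthant s L)) atTop
        (𝓝 (μ.real (lowerOrthant s L))) :=
    (ENNReal.tendsto_toReal (measure_ne_top _ _)).comp
      (ProbabilityMeasure.tendsto_measure_of_null_frontier_of_tendsto' hweak
        (multivariateGaussian_frontier_lowerOrthant hS s L))
  have hνreal (n : ℕ) (s : Finset ι) (L : ι → ℝ) : (ν n).real (lowerOrthant s L) =
      (sourceMeasure P).real {ω | normalizedSum P h n ω ∈ lowerOrthant s L} := by
    rw [Measure.real, Measure.map_apply (measurable_normalizedSum P h n)
      (isClosed_lowerOrthant s L).measurableSet]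
    rfl
  have hsum (n : ℕ) : ∑ x : Fin n → A with ∀ k, ∑ i, h (x i) k ≤ n * R k + √(n : ℝ) * L k,
      ∏ i, P (x i) = (sourceMeasure P).real
        {ω | ∀ k, ∑ i ∈ Finset.range n, h (ω i) k ≤ n * R k + √(n : ℝ) * L k} := by
    rw [← sourceMeasure_real_preimage hP n
      (fun x => ∀ k, ∑ i, h (x i) k ≤ n * R k + √(n : ℝ) * L k)]
    congr 1
    ext ω
    simp only [Set.mem_ofPred_eq]
    refine forall_congr' fun k => ?_
    rw [Fin.sum_univ_eq_sum_range fun i => h (ω i) k]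
  simp only [hsum]
  -- After normalisation the threshold is exactly `L k` for an active coordinate and tends to
  -- infinity for an inactive one.
  have hiff (n : ℕ) (hn : 0 < n) (ω : ℕ → A) (k : ι) :
      ∑ i ∈ Finset.range n, h (ω i) k ≤ n * R k + √(n : ℝ) * L k ↔
        normalizedSum P h n ω k ≤ √(n : ℝ) * (R k - ∑ a, P a * h a k) + L k := by
    have hsq : 0 < √(n : ℝ) := Real.sqrt_pos.2 (by exact_mod_cast hn)
    have hsq2 : √(n : ℝ) * √(n : ℝ) = n := Real.mul_self_sqrt (by positivity)
    change _ ↔ (√(n : ℝ))⁻¹ * (∑ i ∈ Finset.range n, h (ω i) k - n * ∑ a, P a * h a k) ≤ _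
    rw [← div_eq_inv_mul, div_le_iff₀ hsq]
    have : (√(n : ℝ) * (R k - ∑ a, P a * h a k) + L k) * √(n : ℝ) =
        n * R k + √(n : ℝ) * L k - n * ∑ a, P a * h a k := by
      linear_combination (R k - ∑ a, P a * h a k) * hsq2
    rw [this]
    exact (sub_le_sub_iff_right _).symm
  rw [tendsto_order]
  constructor
  · intro a ha
    -- Lower bound: a fixed cap `c` on the inactive coordinates loses little mass and is eventually
    -- below their thresholds.
    obtain ⟨c, hc⟩ := ((tendsto_lowerOrthant_inactive μ s L).eventually_const_lt ha).exists
    have hinact : ∀ᶠ n : ℕ in atTop, ∀ k, k ∉ s →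
        (c : ℝ) ≤ √(n : ℝ) * (R k - ∑ a, P a * h a k) + L k := by
      rw [eventually_all]
      intro k
      by_cases hk : k ∈ s
      · exact .of_forall fun n hk' => absurd hk hk'
      · have hlim : Tendsto (fun n : ℕ => √(n : ℝ) * (R k - ∑ a, P a * h a k) + L k)
            atTop atTop :=
          tendsto_atTop_add_const_right _ _ ((Real.tendsto_sqrt_atTop.comp
            tendsto_natCast_atTop_atTop).atTop_mul_const (sub_pos.2 (hR' k hk)))
        exact (hlim.eventually_ge_atTop _).mono fun n hn _ => hn
    filter_upwards [(hport _ _).eventually_const_lt hc, hinact, eventually_gt_atTop 0]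
      with n h1 h2 hn
    refine h1.trans_le ?_
    rw [hνreal]
    refine measureReal_mono ?_
    intro ω hω k
    rw [hiff n hn]
    have := hω k (Finset.mem_univ k)
    by_cases hk : k ∈ s
    · simpa [hk, hR k hk] using this
    · exact (by simpa [hk] using this : _ ≤ (c : ℝ)).trans (h2 k hk)
  · intro a ha
    -- Upper bound: the inactive constraints are simply dropped.
    filter_upwards [(hport s L).eventually_lt_const ha, eventually_gt_atTop 0] with n h1 hn
    refine lt_of_le_of_lt ?_ h1
    rw [hνreal]
    refine measureReal_mono ?_
    intro ω hω k hk
    have := (hiff n hn ω k).1 (hω k)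
    simpa [hR k hk] using this

end Thresholds

/-! ### Product laws and summed entropy densities -/

section Memoryless

open scoped Topology

lemma marg₁_iidLaw {𝒳₁ 𝒳₂ : Type*} [Fintype 𝒳₂] (P : 𝒳₁ × 𝒳₂ → ℝ) (n : ℕ)
    (a : Fin n → 𝒳₁) :
    marg₁ (iidLaw P n) a = ∏ i, marg₁ P (a i) := by
  classical
  simp only [marg₁, iidLaw]
  rw [Finset.prod_univ_sum, Fintype.piFinset_univ]

lemma marg₂_iidLaw {𝒳₁ 𝒳₂ : Type*} [Fintype 𝒳₁] (P : 𝒳₁ × 𝒳₂ → ℝ) (n : ℕ)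
    (b : Fin n → 𝒳₂) :
    marg₂ (iidLaw P n) b = ∏ i, marg₂ P (b i) := by
  classical
  simp only [marg₂, iidLaw]
  rw [Finset.prod_univ_sum, Fintype.piFinset_univ]

variable {𝒳₁ 𝒳₂ : Type*} [Fintype 𝒳₁] [Fintype 𝒳₂] {P : 𝒳₁ × 𝒳₂ → ℝ}

/-- Pairs of sequences are sequences of pairs. -/
lemma sum_iidLaw_mul (P : 𝒳₁ × 𝒳₂ → ℝ) (n : ℕ)
    (g : (Fin n → 𝒳₁) × (Fin n → 𝒳₂) → ℝ) :
    ∑ x, iidLaw P n x * g x =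
      ∑ x : Fin n → 𝒳₁ × 𝒳₂, (∏ i, P (x i)) * g (fun i => (x i).1, fun i => (x i).2) :=
  (Fintype.sum_equiv (Equiv.arrowProdEquivProdArrow (Fin n) (fun _ => 𝒳₁) (fun _ => 𝒳₂)) _ _
    fun _ => rfl).symm

lemma iidLaw_mem_stdSimplex (hP : P ∈ stdSimplex ℝ (𝒳₁ × 𝒳₂)) (n : ℕ) :
    iidLaw P n ∈ stdSimplex ℝ ((Fin n → 𝒳₁) × (Fin n → 𝒳₂)) := by
  classical
  refine ⟨fun x => Finset.prod_nonneg fun _ _ => hP.1 _, ?_⟩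
  have h := sum_iidLaw_mul P n fun _ => 1
  simp only [mul_one] at h
  rw [h, ← Fintype.piFinset_univ,
    ← Finset.prod_univ_sum (fun _ : Fin n => Finset.univ) fun _ a => P a]
  simp [hP.2]

open Classical in
/-- The probability that the summed entropy densities are bounded by `u`. -/
noncomputable def belowProb (P : 𝒳₁ × 𝒳₂ → ℝ) (n : ℕ) (u : Fin 3 → ℝ) : ℝ :=
  ∑ x : Fin n → 𝒳₁ × 𝒳₂ with ∀ k, ∑ i, entropyDensity P (x i) k ≤ u k, ∏ i, P (x i)

lemma belowProb_mono (hP : P ∈ stdSimplex ℝ (𝒳₁ × 𝒳₂)) (n : ℕ) {u v : Fin 3 → ℝ}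
    (huv : ∀ k, u k ≤ v k) : belowProb P n u ≤ belowProb P n v := by
  classical
  refine Finset.sum_le_sum_of_subset_of_nonneg (fun x hx => ?_)
    fun x _ _ => Finset.prod_nonneg fun _ _ => hP.1 _
  rw [Finset.mem_filter] at hx ⊢
  exact ⟨hx.1, fun k => (hx.2 k).trans (huv k)⟩

/-- Comparing products of positive numbers through sums of base-two logarithms. -/
lemma prod_le_mul_prod_iff {n : ℕ} {p q : Fin n → ℝ} (hp : ∀ i, 0 < p i) (hq : ∀ i, 0 < q i)
    {a : ℝ} (ha : 0 < a) :
    ∏ i, q i ≤ a * ∏ i, p i ↔ ∑ i, Real.logb 2 (1 / (p i / q i)) ≤ Real.logb 2 a := by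
  have hpp : 0 < ∏ i, p i := Finset.prod_pos fun i _ => hp i
  have hqq : 0 < ∏ i, q i := Finset.prod_pos fun i _ => hq i
  rw [← Real.logb_le_logb (b := 2) (by norm_num) hqq (by positivity),
    Real.logb_mul ha.ne' hpp.ne', Real.logb_prod _ _ fun i _ => (hp i).ne',
    Real.logb_prod _ _ fun i _ => (hq i).ne', ← sub_le_iff_le_add, ← Finset.sum_sub_distrib]
  simp only [one_div_div]
  rw [Finset.sum_congr rfl fun i _ => Real.logb_div (hq i).ne' (hp i).ne']

/-- For a memoryless source the likely set is described by the summed entropy densities. -/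
lemma sum_likelySet_iidLaw (hP : P ∈ stdSimplex ℝ (𝒳₁ × 𝒳₂)) (n : ℕ) {a b c : ℝ} (ha : 0 < a)
    (hb : 0 < b) (hc : 0 < c) :
    ∑ x ∈ likelySet (iidLaw P n) a b c, iidLaw P n x =
      belowProb P n ![Real.logb 2 a, Real.logb 2 b, Real.logb 2 c] := by
  classical
  have h := sum_iidLaw_mul P n fun x => if x ∈ likelySet (iidLaw P n) a b c then 1 else 0
  simp only [mul_ite, mul_one, mul_zero, Finset.sum_ite_mem_eq] at h
  rw [h, belowProb, Finset.sum_filter]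
  refine Finset.sum_congr rfl fun x _ => ?_
  by_cases hx : ∀ i, 0 < P (x i)
  · refine if_congr ?_ rfl rfl
    have h₁ : ∀ i, 0 < marg₁ P (x i).1 := fun i => (hx i).trans_le (le_marg₁ hP.1 _)
    have h₂ : ∀ i, 0 < marg₂ P (x i).2 := fun i => (hx i).trans_le (le_marg₂ hP.1 _)
    have hlaw : iidLaw P n (fun i => (x i).1, fun i => (x i).2) = ∏ i, P (x i) := rfl
    simp only [likelySet, Finset.mem_filter, Finset.mem_univ, true_and, marg₁_iidLaw,
      marg₂_iidLaw, hlaw, Fin.forall_fin_succ, IsEmpty.forall_iff, and_true]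
    have h3 := prod_le_mul_prod_iff hx (q := fun _ => 1) (fun _ => one_pos) hc
    simp only [Finset.prod_const_one, div_one] at h3
    exact and_congr (prod_le_mul_prod_iff hx h₂ ha)
      (and_congr (prod_le_mul_prod_iff hx h₁ hb) h3)
  -- If some letter has mass zero, the word has mass zero, so the two descriptions of the set may
  -- disagree on it.
  · push Not at hx
    obtain ⟨i, hi⟩ := hx
    have h0 : ∏ i, P (x i) = 0 :=
      Finset.prod_eq_zero (Finset.mem_univ i) (le_antisymm hi (hP.1 _))
    simp [h0]

end Memoryless

/-! ### From one-shot bounds to the second-order region -/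

section Region

open scoped Topology

lemma limsup_coe_le_of_eventually_le {f g : ℕ → ℝ} {a : ℝ} (hfg : ∀ᶠ n in atTop, f n ≤ g n)
    (hg : Tendsto g atTop (𝓝 a)) : limsup (fun n => (f n : EReal)) atTop ≤ (a : EReal) :=
  calc limsup (fun n => (f n : EReal)) atTop ≤ limsup (fun n => (g n : EReal)) atTop :=
        limsup_le_limsup (hfg.mono fun _ h => EReal.coe_le_coe_iff.2 h)
    _ = a := ((continuous_coe_real_ereal.tendsto a).comp hg).limsup_eq

lemma eventually_lt_of_limsup_coe_le {f : ℕ → ℝ} {a b : ℝ}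
    (h : limsup (fun n => (f n : EReal)) atTop ≤ (a : EReal)) (hab : a < b) :
    ∀ᶠ n in atTop, f n < b :=
  (eventually_lt_of_limsup_lt (h.trans_lt (EReal.coe_lt_coe_iff.2 hab))).mono
    fun _ hn => EReal.coe_lt_coe_iff.1 hn

lemma tendsto_sqrt_natCast : Tendsto (fun n : ℕ => √(n : ℝ)) atTop atTop :=
  Real.tendsto_sqrt_atTop.comp tendsto_natCast_atTop_atTop

lemma tendsto_two_rpow_neg {g : ℕ → ℝ} (hg : Tendsto g atTop atTop) :
    Tendsto (fun n => (2 : ℝ) ^ (-g n)) atTop (𝓝 0) :=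
  (tendsto_rpow_atBot_of_base_gt_one 2 one_lt_two).comp (tendsto_neg_atTop_atBot.comp hg)

/-- Rounding `2 ^ y` up costs at most one bit. -/
lemma logb_natCeil_two_rpow_le {y : ℝ} (hy : 0 ≤ y) :
    Real.logb 2 (⌈(2 : ℝ) ^ y⌉₊ : ℝ) ≤ y + 1 := by
  have h1 : (1 : ℝ) ≤ 2 ^ y := Real.one_le_rpow one_le_two hy
  have hpos : (0 : ℝ) < ⌈(2 : ℝ) ^ y⌉₊ := lt_of_lt_of_le (by positivity) (Nat.le_ceil _)
  rw [Real.logb_le_iff_le_rpow one_lt_two hpos, Real.rpow_add two_pos, Real.rpow_one]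
  have := (Nat.ceil_lt_add_one (by positivity : (0 : ℝ) ≤ 2 ^ y)).le
  linarith

lemma le_logb_natCeil_two_rpow (y : ℝ) : y ≤ Real.logb 2 (⌈(2 : ℝ) ^ y⌉₊ : ℝ) := by
  have hpos : (0 : ℝ) < ⌈(2 : ℝ) ^ y⌉₊ := lt_of_lt_of_le (by positivity) (Nat.le_ceil _)
  rw [Real.le_logb_iff_rpow_le one_lt_two hpos]
  exact Nat.le_ceil _

/-- Codebooks of about `2 ^ (n R + √n L + 2 n ^ (1 / 4))` elements have second-order rate at
most `L`. -/
lemma limsup_secondOrderRate_le {R : ℝ} (hR : 0 < R) (L : ℝ) :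
    limsup (fun n : ℕ => (((Real.logb 2 (⌈(2 : ℝ) ^
      (n * R + √(n : ℝ) * L + 2 * √√(n : ℝ))⌉₊ : ℝ) - n * R) / √(n : ℝ) : ℝ) : EReal)) atTop ≤
      (L : EReal) := by
  have hs := tendsto_sqrt_natCast
  have hss : Tendsto (fun n : ℕ => √√(n : ℝ)) atTop atTop := Real.tendsto_sqrt_atTop.comp hs
  have hlarge : ∀ᶠ n : ℕ in atTop, 0 ≤ √(n : ℝ) * R + L :=
    (tendsto_atTop_add_const_right _ _ (hs.atTop_mul_const hR)).eventually_ge_atTop 0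
  refine limsup_coe_le_of_eventually_le (g := fun n : ℕ => L + 2 * (√√(n : ℝ))⁻¹ + (√(n : ℝ))⁻¹)
    ?_ ?_
  · filter_upwards [hlarge, eventually_gt_atTop 0] with n hn hpos
    have hsq : 0 < √(n : ℝ) := Real.sqrt_pos.2 (by exact_mod_cast hpos)
    have hsq2 : √(n : ℝ) * √(n : ℝ) = n := Real.mul_self_sqrt (by positivity)
    have hssq : 0 < √√(n : ℝ) := Real.sqrt_pos.2 hsq
    have hssq2 : √√(n : ℝ) * √√(n : ℝ) = √(n : ℝ) := Real.mul_self_sqrt hsq.le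
    have hy : 0 ≤ n * R + √(n : ℝ) * L + 2 * √√(n : ℝ) := by
      have h1 : n * R + √(n : ℝ) * L = √(n : ℝ) * (√(n : ℝ) * R + L) := by
        linear_combination -R * hsq2
      rw [h1]
      positivity
    rw [div_le_iff₀ hsq]
    have h2 : (L + 2 * (√√(n : ℝ))⁻¹ + (√(n : ℝ))⁻¹) * √(n : ℝ) =
        √(n : ℝ) * L + 2 * √√(n : ℝ) + 1 := by
      have h3 : (√√(n : ℝ))⁻¹ * √(n : ℝ) = √√(n : ℝ) := by
        rw [inv_mul_eq_iff_eq_mul₀ hssq.ne', hssq2]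
      have h4 : (√(n : ℝ))⁻¹ * √(n : ℝ) = 1 := inv_mul_cancel₀ hsq.ne'
      linear_combination 2 * h3 + h4
    rw [h2]
    linarith [logb_natCeil_two_rpow_le hy]
  · simpa using ((tendsto_inv_atTop_zero.comp hss).const_mul 2).const_add L |>.add
      (tendsto_inv_atTop_zero.comp hs)

variable {𝒳₁ 𝒳₂ : Type*} [Fintype 𝒳₁] [Fintype 𝒳₂] {P : 𝒳₁ × 𝒳₂ → ℝ}

/-- Achievability of second-order rates. -/
lemma mem_secondOrderRegion_of_le (hP : P ∈ stdSimplex ℝ (𝒳₁ × 𝒳₂)) {R₁ R₂ : ℝ} (hR₁ : 0 < R₁)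
    (hR₂ : 0 < R₂) {L₁ L₂ ε p : ℝ}
    (hlim : Tendsto (fun n : ℕ => belowProb P n fun k =>
      n * ![R₁, R₂, R₁ + R₂] k + √(n : ℝ) * ![L₁, L₂, L₁ + L₂] k) atTop (𝓝 p))
    (hp : 1 - ε ≤ p) : (L₁, L₂) ∈ secondOrderRegion P ε R₁ R₂ := by
  have hss : Tendsto (fun n : ℕ => √√(n : ℝ)) atTop atTop :=
    Real.tendsto_sqrt_atTop.comp tendsto_sqrt_natCast
  let M (R L : ℝ) (n : ℕ) : ℕ := ⌈(2 : ℝ) ^ (n * R + √(n : ℝ) * L + 2 * √√(n : ℝ))⌉₊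
  have hM (R L : ℝ) (n : ℕ) : 0 < M R L n := Nat.ceil_pos.2 (by positivity)
  -- The choice `θ = 2 ^ (-n ^ (1 / 4))` tends to zero, yet costs only `n ^ (1 / 4) = o(√n)` bits,
  -- which the extra term in `M` covers.
  choose c hc using fun n => exists_code_errorProb_le_likelySet (iidLaw_mem_stdSimplex hP n)
    (hM R₁ L₁ n) (hM R₂ L₂ n) (θ := 2 ^ (-√√(n : ℝ))) (by positivity)
  refine ⟨M R₁ L₁, M R₂ L₂, _, c, fun n => le_rfl, ?_, limsup_secondOrderRate_le hR₁ L₁,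
    limsup_secondOrderRate_le hR₂ L₂⟩
  refine (limsup_coe_le_of_eventually_le (g := fun n : ℕ => 1 - (belowProb P n fun k =>
      n * ![R₁, R₂, R₁ + R₂] k + √(n : ℝ) * ![L₁, L₂, L₁ + L₂] k) + 3 * 2 ^ (-√√(n : ℝ)))
      (a := 1 - p) (.of_forall fun n => (hc n).trans ?_) ?_).trans
      (EReal.coe_le_coe_iff.2 (by linarith))
  · have h₁ : (0 : ℝ) < M R₁ L₁ n := by exact_mod_cast hM R₁ L₁ n
    have h₂ : (0 : ℝ) < M R₂ L₂ n := by exact_mod_cast hM R₂ L₂ n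
    have hθ : (0 : ℝ) < 2 ^ (-√√(n : ℝ)) := by positivity
    have hlogθ : Real.logb 2 ((2 : ℝ) ^ (-√√(n : ℝ))) = -√√(n : ℝ) :=
      Real.logb_rpow two_pos (by norm_num)
    rw [sum_likelySet_iidLaw hP n (by positivity) (by positivity) (by positivity)]
    gcongr
    refine belowProb_mono hP n fun k => ?_
    have hl₁ := le_logb_natCeil_two_rpow (n * R₁ + √(n : ℝ) * L₁ + 2 * √√(n : ℝ))
    have hl₂ := le_logb_natCeil_two_rpow (n * R₂ + √(n : ℝ) * L₂ + 2 * √√(n : ℝ))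
    have h0 := Real.sqrt_nonneg √(n : ℝ)
    rw [Real.logb_mul hθ.ne' h₁.ne', Real.logb_mul hθ.ne' h₂.ne', Real.logb_mul hθ.ne'
      (mul_pos h₁ h₂).ne', Real.logb_mul h₁.ne' h₂.ne', hlogθ]
    fin_cases k
    · change n * R₁ + √(n : ℝ) * L₁ ≤ -√√(n : ℝ) + Real.logb 2 (M R₁ L₁ n)
      linarith
    · change n * R₂ + √(n : ℝ) * L₂ ≤ -√√(n : ℝ) + Real.logb 2 (M R₂ L₂ n)
      linarith
    · change n * (R₁ + R₂) + √(n : ℝ) * (L₁ + L₂) ≤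
        -√√(n : ℝ) + (Real.logb 2 (M R₁ L₁ n) + Real.logb 2 (M R₂ L₂ n))
      linarith
  · simpa using (hlim.const_sub 1).add ((tendsto_two_rpow_neg hss).const_mul 3)

/-- The converse for second-order rates, up to a slack `δ`. -/
lemma le_of_mem_secondOrderRegion (hP : P ∈ stdSimplex ℝ (𝒳₁ × 𝒳₂)) {R₁ R₂ L₁ L₂ ε p δ : ℝ}
    (hδ : 0 < δ) (hL : (L₁, L₂) ∈ secondOrderRegion P ε R₁ R₂)
    (hlim : Tendsto (fun n : ℕ => belowProb P n fun k =>
      n * ![R₁, R₂, R₁ + R₂] k + √(n : ℝ) * (![L₁, L₂, L₁ + L₂] k + ![2, 2, 3] k * δ))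
      atTop (𝓝 p)) : 1 - ε ≤ p := by
  obtain ⟨M₁, M₂, e, c, hce, he, hr₁, hr₂⟩ := hL
  have hne : Nonempty (𝒳₁ × 𝒳₂) := by
    by_contra h
    rw [not_nonempty_iff] at h
    simpa using hP.2
  obtain ⟨⟨x₁, x₂⟩⟩ := hne
  -- The encoders map nonempty sets, so they supply elements of the codebooks.
  have hM₁ (n : ℕ) : 0 < M₁ n := ((c n).enc₁ fun _ => x₁).pos
  have hM₂ (n : ℕ) : 0 < M₂ n := ((c n).enc₂ fun _ => x₂).pos
  have hs : Tendsto (fun n : ℕ => √(n : ℝ) * δ) atTop atTop :=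
    tendsto_sqrt_natCast.atTop_mul_const hδ
  refine le_of_forall_pos_le_add fun η hη => ?_
  have hlim' := (hlim.add ((tendsto_two_rpow_neg hs).const_mul 3)).add_const η
  rw [mul_zero, add_zero] at hlim'
  refine ge_of_tendsto hlim' ?_
  filter_upwards [eventually_lt_of_limsup_coe_le he (lt_add_of_pos_right ε hη),
    eventually_lt_of_limsup_coe_le hr₁ (lt_add_of_pos_right L₁ hδ),
    eventually_lt_of_limsup_coe_le hr₂ (lt_add_of_pos_right L₂ hδ), eventually_gt_atTop 0]
    with n hen hn₁ hn₂ hn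
  have hsq : 0 < √(n : ℝ) := Real.sqrt_pos.2 (by exact_mod_cast hn)
  have h₁ : (0 : ℝ) < M₁ n := by exact_mod_cast hM₁ n
  have h₂ : (0 : ℝ) < M₂ n := by exact_mod_cast hM₂ n
  have hθ : (0 : ℝ) < 2 ^ (-(√(n : ℝ) * δ)) := by positivity
  have hlogθ : Real.logb 2 ((2 : ℝ) ^ (-(√(n : ℝ) * δ))) = -(√(n : ℝ) * δ) :=
    Real.logb_rpow two_pos (by norm_num)
  have hconv := one_sub_errorProb_le_likelySet (iidLaw_mem_stdSimplex hP n) (hM₁ n) (hM₂ n) (c n) hθ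
  rw [sum_likelySet_iidLaw hP n (by positivity) (by positivity) (by positivity)] at hconv
  -- Each `log M_j` exceeds its target by less than `√n δ`, and division by `θ = 2 ^ (-√n δ)` adds
  -- another `√n δ`: in all two, two and, for the sum rate, three.
  have hmono := belowProb_mono hP n
    (u := ![Real.logb 2 (M₁ n / 2 ^ (-(√(n : ℝ) * δ))), Real.logb 2 (M₂ n / 2 ^ (-(√(n : ℝ) * δ))),
      Real.logb 2 (M₁ n * M₂ n / 2 ^ (-(√(n : ℝ) * δ)))])
    (v := fun k => n * ![R₁, R₂, R₁ + R₂] k +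
      √(n : ℝ) * (![L₁, L₂, L₁ + L₂] k + ![2, 2, 3] k * δ)) fun k => by
    rw [div_lt_iff₀ hsq] at hn₁ hn₂
    rw [Real.logb_div h₁.ne' hθ.ne', Real.logb_div h₂.ne' hθ.ne',
      Real.logb_div (mul_pos h₁ h₂).ne' hθ.ne', Real.logb_mul h₁.ne' h₂.ne', hlogθ]
    fin_cases k
    · change Real.logb 2 (M₁ n) - -(√(n : ℝ) * δ) ≤ n * R₁ + √(n : ℝ) * (L₁ + 2 * δ)
      linarith
    · change Real.logb 2 (M₂ n) - -(√(n : ℝ) * δ) ≤ n * R₂ + √(n : ℝ) * (L₂ + 2 * δ)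
      linarith
    · change Real.logb 2 (M₁ n) + Real.logb 2 (M₂ n) - -(√(n : ℝ) * δ) ≤
        n * (R₁ + R₂) + √(n : ℝ) * (L₁ + L₂ + 3 * δ)
      linarith
  have := hce n
  linarith

/-- The second-order region in terms of the Gaussian law of the active constraints. -/
lemma mem_secondOrderRegion_iff (hP : P ∈ stdSimplex ℝ (𝒳₁ × 𝒳₂)) (hV : (dispersion P).PosDef)
    (s : Finset (Fin 3)) {R₁ R₂ : ℝ} (hR₁ : 0 < R₁) (hR₂ : 0 < R₂)
    (hR : ∀ k ∈ s, ![R₁, R₂, R₁ + R₂] k = ∑ x, P x * entropyDensity P x k)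
    (hR' : ∀ k ∉ s, ∑ x, P x * entropyDensity P x k < ![R₁, R₂, R₁ + R₂] k) (ε L₁ L₂ : ℝ) :
    (L₁, L₂) ∈ secondOrderRegion P ε R₁ R₂ ↔
      1 - ε ≤ (multivariateGaussian 0 (dispersion P)).real
        (lowerOrthant s ![L₁, L₂, L₁ + L₂]) := by
  have hlim (L : Fin 3 → ℝ) : Tendsto (fun n : ℕ => belowProb P n fun k =>
      n * ![R₁, R₂, R₁ + R₂] k + √(n : ℝ) * L k) atTop
      (𝓝 ((multivariateGaussian 0 (dispersion P)).real (lowerOrthant s L))) := by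
    refine (tendsto_sum_le_thresholds hP (entropyDensity P) hV (fun j k => ?_) s _ L hR hR').congr
      fun n => ?_
    · simp only [dispersion, Matrix.of_apply, expect]
    · unfold belowProb
      congr!
  constructor
  · intro hL
    refine le_lowerOrthant_of_forall_pos _ s _ ![2, 2, 3] (fun k => ?_) fun δ hδ =>
      le_of_mem_secondOrderRegion hP hδ hL (hlim _)
    fin_cases k <;> norm_num
  · exact mem_secondOrderRegion_of_le hP hR₁ hR₂ (hlim _)

end Region

/-! ### Entropy identities and consequences of nondegeneracy -/

section Information

variable {𝒳₁ 𝒳₂ : Type*} [Fintype 𝒳₁] [Fintype 𝒳₂] {P : 𝒳₁ × 𝒳₂ → ℝ}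

lemma sum_mul_entropyDensity_zero (P : 𝒳₁ × 𝒳₂ → ℝ) :
    ∑ x, P x * entropyDensity P x 0 = condEntropy₁ P := by
  simp [entropyDensity, condEntropy₁, Real.logb_inv]

lemma sum_mul_entropyDensity_one (P : 𝒳₁ × 𝒳₂ → ℝ) :
    ∑ x, P x * entropyDensity P x 1 = condEntropy₂ P := by
  simp [entropyDensity, condEntropy₂, Real.logb_inv]

lemma sum_mul_entropyDensity_two (P : 𝒳₁ × 𝒳₂ → ℝ) :
    ∑ x, P x * entropyDensity P x 2 = entropy P := by
  simp [entropyDensity, entropy, Real.logb_inv]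

lemma entropy_marg₁ (P : 𝒳₁ × 𝒳₂ → ℝ) :
    entropy (marg₁ P) = -∑ x, P x * Real.logb 2 (marg₁ P x.1) := by
  simp only [entropy, Fintype.sum_prod_type, ← Finset.sum_mul]
  rfl

lemma entropy_marg₂ (P : 𝒳₁ × 𝒳₂ → ℝ) :
    entropy (marg₂ P) = -∑ x, P x * Real.logb 2 (marg₂ P x.2) := by
  simp only [entropy, Fintype.sum_prod_type_right, ← Finset.sum_mul]
  rfl

/-- The chain rule `H(X₁, X₂) = H(X₁|X₂) + H(X₂)`. -/
lemma entropy_eq_condEntropy₁_add (hP : P ∈ stdSimplex ℝ (𝒳₁ × 𝒳₂)) :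
    entropy P = condEntropy₁ P + entropy (marg₂ P) := by
  rw [entropy_marg₂, entropy, condEntropy₁, ← neg_add, ← Finset.sum_add_distrib]
  congr 1
  refine Finset.sum_congr rfl fun x _ => ?_
  rcases (hP.1 x).eq_or_lt with h | h
  · simp [← h]
  · rw [cond₁, Real.logb_div h.ne' (h.trans_le (le_marg₂ hP.1 x)).ne']
    ring

/-- The chain rule `H(X₁, X₂) = H(X₂|X₁) + H(X₁)`. -/
lemma entropy_eq_condEntropy₂_add (hP : P ∈ stdSimplex ℝ (𝒳₁ × 𝒳₂)) :
    entropy P = condEntropy₂ P + entropy (marg₁ P) := by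
  rw [entropy_marg₁, entropy, condEntropy₂, ← neg_add, ← Finset.sum_add_distrib]
  congr 1
  refine Finset.sum_congr rfl fun x _ => ?_
  rcases (hP.1 x).eq_or_lt with h | h
  · simp [← h]
  · rw [cond₂, Real.logb_div h.ne' (h.trans_le (le_marg₁ hP.1 x)).ne']
    ring

lemma entropyDensity_nonneg (hP : P ∈ stdSimplex ℝ (𝒳₁ × 𝒳₂)) {x : 𝒳₁ × 𝒳₂} (hx : 0 < P x)
    (k : Fin 3) : 0 ≤ entropyDensity P x k := by
  have h₁ := le_marg₁ hP.1 x
  have h₂ := le_marg₂ hP.1 x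
  have h₃ : P x ≤ 1 := hP.2 ▸ Finset.single_le_sum (fun y _ => hP.1 y) (Finset.mem_univ x)
  fin_cases k
  · refine Real.logb_nonneg one_lt_two ?_
    rwa [cond₁, one_div_div, one_le_div hx]
  · refine Real.logb_nonneg one_lt_two ?_
    rwa [cond₂, one_div_div, one_le_div hx]
  · refine Real.logb_nonneg one_lt_two ?_
    rwa [one_le_div hx]

/-- A linear combination of entropy densities that vanishes almost surely vanishes identically
when the dispersion matrix is nondegenerate. -/
lemma eq_zero_of_sum_entropyDensity_eq_zero (hV : (dispersion P).PosDef)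
    (hP : P ∈ stdSimplex ℝ (𝒳₁ × 𝒳₂)) (w : Fin 3 → ℝ)
    (hw : ∀ x, 0 < P x → ∑ k, w k * entropyDensity P x k = 0) : w = 0 := by
  by_contra hne
  have hpos := hV.dotProduct_mulVec_pos hne
  have hmean : ∑ k, w k * ∑ y, P y * entropyDensity P y k = 0 := by
    simp only [Finset.mul_sum]
    rw [Finset.sum_comm]
    refine Finset.sum_eq_zero fun y _ => ?_
    rcases (hP.1 y).eq_or_lt with h | h
    · simp [← h]
    · rw [← mul_zero (P y), ← hw y h, Finset.mul_sum]
      exact Finset.sum_congr rfl fun k _ => by ring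
  refine hpos.ne' ?_
  -- The quadratic form is the variance of the linear combination with weights `w`.
  have hquad : star w ⬝ᵥ (dispersion P).mulVec w =
      ∑ x, P x * (∑ k, w k * (entropyDensity P x k - ∑ y, P y * entropyDensity P y k)) ^ 2 := by
    simp only [dotProduct, Matrix.mulVec, dispersion, Matrix.of_apply, expect, star_trivial, sq,
      Finset.mul_sum, Finset.sum_mul]
    symm
    rw [Finset.sum_comm]
    refine Finset.sum_congr rfl fun j _ => ?_
    rw [Finset.sum_comm]
    exact Finset.sum_congr rfl fun k _ => Finset.sum_congr rfl fun b _ => by ring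
  rw [hquad]
  refine Finset.sum_eq_zero fun x _ => ?_
  rcases (hP.1 x).eq_or_lt with h | h
  · simp [← h]
  · simp only [mul_sub, Finset.sum_sub_distrib, hmean, hw x h]
    simp

/-- A vanishing mean would force a nonnegative density to vanish on the support, contradicting
nondegeneracy. This makes the rates positive, as achievability requires. -/
lemma sum_mul_entropyDensity_pos (hP : P ∈ stdSimplex ℝ (𝒳₁ × 𝒳₂)) (hV : (dispersion P).PosDef)
    (k : Fin 3) : 0 < ∑ x, P x * entropyDensity P x k := by
  have hnn (x : 𝒳₁ × 𝒳₂) : 0 ≤ P x * entropyDensity P x k := by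
    rcases (hP.1 x).eq_or_lt with h | h
    · simp [← h]
    · exact mul_nonneg h.le (entropyDensity_nonneg hP h k)
  refine lt_of_le_of_ne (Finset.sum_nonneg fun x _ => hnn x) fun h0 => ?_
  have hz := (Finset.sum_eq_zero_iff_of_nonneg fun x _ => hnn x).1 h0.symm
  have := eq_zero_of_sum_entropyDensity_eq_zero hV hP (Pi.single k 1) fun x hx => by
    rcases mul_eq_zero.1 (hz x (Finset.mem_univ x)) with h | h
    · exact absurd h hx.ne'
    · simp [Pi.single_apply, h]
  simpa using congrFun this k

/-- Nondegenerate dispersion forces positive mutual information: `H(X₂|X₁) < H(X₂)`. -/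
lemma condEntropy₂_lt_entropy_marg₂ (hP : P ∈ stdSimplex ℝ (𝒳₁ × 𝒳₂))
    (hV : (dispersion P).PosDef) : condEntropy₂ P < entropy (marg₂ P) := by
  obtain ⟨x₀, hx₀, hne⟩ : ∃ x, 0 < P x ∧ marg₁ P x.1 * marg₂ P x.2 / P x ≠ 1 := by
    by_contra! hall
    -- These weights produce `log (P₁ P₂ / P)`, which would vanish on the support if the ratio were
    -- always one.
    have := eq_zero_of_sum_entropyDensity_eq_zero hV hP ![1, 1, -1] fun x hx => by
      have h₁ := hx.trans_le (le_marg₁ hP.1 x)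
      have h₂ := hx.trans_le (le_marg₂ hP.1 x)
      have hlog := congrArg (Real.logb 2) (hall x hx)
      rw [Real.logb_one, Real.logb_div (mul_pos h₁ h₂).ne' hx.ne', Real.logb_mul h₁.ne' h₂.ne']
        at hlog
      simp only [Fin.sum_univ_three, entropyDensity, cond₁, cond₂, one_div_div,
        Matrix.cons_val_zero, Matrix.cons_val_one, Matrix.cons_val]
      rw [Real.logb_div h₂.ne' hx.ne', Real.logb_div h₁.ne' hx.ne', one_div, Real.logb_inv]
      linarith
    simpa using congrFun this 0
  have hlog2 : 0 < Real.log 2 := Real.log_pos one_lt_two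
  have hterm (x : 𝒳₁ × 𝒳₂) (hx : 0 < P x) :
      P x * (Real.logb 2 (marg₂ P x.2) - Real.logb 2 (cond₂ P x)) * Real.log 2 =
        P x * Real.log (marg₁ P x.1 * marg₂ P x.2 / P x) := by
    have h₁ := hx.trans_le (le_marg₁ hP.1 x)
    have h₂ := hx.trans_le (le_marg₂ hP.1 x)
    rw [cond₂, Real.log_div (mul_pos h₁ h₂).ne' hx.ne', Real.log_mul h₁.ne' h₂.ne',
      Real.logb_div hx.ne' h₁.ne', Real.logb, Real.logb, Real.logb]
    field_simp
    ring
  -- Gibbs' inequality via `log t ≤ t - 1`, strict at `x₀`; the right sides sum to zero because both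
  -- laws have mass one.
  have hle (x : 𝒳₁ × 𝒳₂) :
      P x * (Real.logb 2 (marg₂ P x.2) - Real.logb 2 (cond₂ P x)) * Real.log 2 ≤
        marg₁ P x.1 * marg₂ P x.2 - P x := by
    rcases (hP.1 x).eq_or_lt with h | h
    · rw [← h]
      simpa using mul_nonneg (marg₁_nonneg hP.1 x.1) (marg₂_nonneg hP.1 x.2)
    · have h₁ := h.trans_le (le_marg₁ hP.1 x)
      have h₂ := h.trans_le (le_marg₂ hP.1 x)
      rw [hterm x h]
      calc _ ≤ P x * (marg₁ P x.1 * marg₂ P x.2 / P x - 1) :=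
            mul_le_mul_of_nonneg_left (Real.log_le_sub_one_of_pos (by positivity)) h.le
        _ = _ := by field_simp
  have hlt : P x₀ * (Real.logb 2 (marg₂ P x₀.2) - Real.logb 2 (cond₂ P x₀)) * Real.log 2 <
      marg₁ P x₀.1 * marg₂ P x₀.2 - P x₀ := by
    have h₁ := hx₀.trans_le (le_marg₁ hP.1 x₀)
    have h₂ := hx₀.trans_le (le_marg₂ hP.1 x₀)
    rw [hterm x₀ hx₀]
    calc _ < P x₀ * (marg₁ P x₀.1 * marg₂ P x₀.2 / P x₀ - 1) :=
          mul_lt_mul_of_pos_left (Real.log_lt_sub_one_of_pos (by positivity) hne) hx₀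
      _ = _ := by field_simp
  have hsum := Finset.sum_lt_sum (fun x _ => hle x) ⟨x₀, Finset.mem_univ _, hlt⟩
  have hzero : ∑ x : 𝒳₁ × 𝒳₂, (marg₁ P x.1 * marg₂ P x.2 - P x) = 0 := by
    rw [Finset.sum_sub_distrib, hP.2, Fintype.sum_prod_type]
    simp only [← Finset.mul_sum, sum_marg₂, hP.2, mul_one, sum_marg₁, sub_self]
  rw [hzero, ← Finset.sum_mul] at hsum
  have hneg := neg_of_mul_neg_left hsum hlog2.le
  rw [entropy_marg₂, condEntropy₂]
  simp only [mul_sub, Finset.sum_sub_distrib] at hneg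
  linarith

end Information

/-! ### Gaussian marginals and quantiles -/

section GaussianMarginals

open scoped Matrix RealInnerProductSpace Topology

/-- The coordinates of a Gaussian vector along a map of index sets are again Gaussian. -/
lemma multivariateGaussian_map_submatrix {ι κ : Type*} [Fintype ι] [DecidableEq ι] [Fintype κ]
    [DecidableEq κ] {S : Matrix ι ι ℝ} (hS : S.PosSemidef) (e : κ → ι) :
    (multivariateGaussian 0 S).map (fun z => WithLp.toLp 2 fun j => z (e j)) =
      multivariateGaussian (0 : EuclideanSpace ℝ κ) (S.submatrix e e) := by
  have hmeas : Measurable fun z : EuclideanSpace ℝ ι =>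
    (WithLp.toLp 2 fun j => z (e j) : EuclideanSpace ℝ κ) := by fun_prop
  have := Measure.isProbabilityMeasure_map (μ := multivariateGaussian 0 S) hmeas.aemeasurable
  refine Measure.ext_of_charFun (funext fun y => ?_)
  -- The adjoint of coordinate selection applied to `y`; entries add up when `e` repeats an index.
  let t : EuclideanSpace ℝ ι := WithLp.toLp 2 fun k => ∑ j, if e j = k then y j else 0
  have hsum (g : ι → ℝ) : ∑ k, t k * g k = ∑ j, y j * g (e j) := by
    simp only [t, Finset.sum_mul, ite_mul, zero_mul]
    rw [Finset.sum_comm]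
    simp
  have hleft : charFun ((multivariateGaussian 0 S).map
      (fun z => WithLp.toLp 2 fun j => z (e j))) y = charFun (multivariateGaussian 0 S) t := by
    rw [charFun_apply, charFun_apply, integral_map hmeas.aemeasurable (by fun_prop)]
    congr 1
    funext z
    congr 3
    simp only [PiLp.inner_apply, RCLike.inner_apply, conj_trivial]
    exact (hsum fun k => z k).symm
  rw [hleft, charFun_multivariateGaussian hS, charFun_multivariateGaussian (hS.submatrix e)]
  have hquad : t.ofLp ⬝ᵥ S *ᵥ t.ofLp = y.ofLp ⬝ᵥ S.submatrix e e *ᵥ y.ofLp := by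
    simp only [dotProduct, Matrix.mulVec, Matrix.submatrix_apply]
    rw [hsum fun k => ∑ l, S k l * t l]
    refine Finset.sum_congr rfl fun j _ => ?_
    congr 1
    simp only [mul_comm (S _ _)]
    exact hsum fun l => S (e j) l
  rw [hquad]
  simp

lemma lowerOrthant_pair_real {S : Matrix (Fin 3) (Fin 3) ℝ} (hS : S.PosSemidef) (i j : Fin 3)
    (L : Fin 3 → ℝ) :
    (multivariateGaussian 0 S).real (lowerOrthant {i, j} L) =
      bivariateGaussianCDF (L i) (L j) 0 (S.submatrix ![i, j] ![i, j]) := by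
  have hmeas : Measurable fun z : EuclideanSpace ℝ (Fin 3) =>
    (WithLp.toLp 2 fun k => z (![i, j] k) : EuclideanSpace ℝ (Fin 2)) := by fun_prop
  have hset : MeasurableSet {x : EuclideanSpace ℝ (Fin 2) | x 0 ≤ L i ∧ x 1 ≤ L j} := by
    rw [Set.ofPred_and]
    exact (measurableSet_le (by fun_prop) measurable_const).inter
      (measurableSet_le (by fun_prop) measurable_const)
  rw [bivariateGaussianCDF, ← multivariateGaussian_map_submatrix hS ![i, j],
    map_measureReal_apply hmeas hset]
  congr 1
  ext z
  simp [lowerOrthant]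

lemma lowerOrthant_singleton_real {S : Matrix (Fin 3) (Fin 3) ℝ} (hS : S.PosDef) (i : Fin 3)
    (L : Fin 3 → ℝ) :
    (multivariateGaussian 0 S).real (lowerOrthant {i} L) =
      cdf (gaussianReal 0 1) (L i / √(S i i)) := by
  have hpos : 0 < S i i := hS.diag_pos
  have hp := measurePreserving_eval_multivariateGaussian (μ := 0) hS.posSemidef (i := i)
  have hset : lowerOrthant {i} L = (fun z : EuclideanSpace ℝ (Fin 3) => z i) ⁻¹' Set.Iic (L i) := by
    ext z
    simp [lowerOrthant]
  have hσ : 0 < √(S i i) := Real.sqrt_pos.2 hpos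
  have hscale : gaussianReal ((0 : EuclideanSpace ℝ (Fin 3)) i) (S i i).toNNReal =
      (gaussianReal 0 1).map (√(S i i) * ·) := by
    rw [gaussianReal_map_const_mul]
    congr 1
    · simp
    · ext
      simp [Real.sq_sqrt hpos.le, hpos.le]
  rw [hset, hp.measureReal_preimage measurableSet_Iic.nullMeasurableSet, cdf_eq_real, hscale,
    map_measureReal_apply (by fun_prop) measurableSet_Iic]
  congr 1
  ext y
  simp only [Set.mem_preimage, Set.mem_Iic, le_div_iff₀ hσ, mul_comm]

/-- Lebesgue measure is absolutely continuous with respect to the Gaussian, so no nontrivial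
interval has Gaussian mass zero. -/
lemma strictMono_cdf_gaussianReal : StrictMono (cdf (gaussianReal 0 1)) := by
  intro x y hxy
  have hne : (cdf (gaussianReal 0 1)).measure (Set.Ioc x y) ≠ 0 := fun h0 => by
    rw [measure_cdf] at h0
    have := gaussianReal_absolutelyContinuous' 0 one_ne_zero h0
    rw [Real.volume_Ioc, ENNReal.ofReal_eq_zero] at this
    linarith
  rw [StieltjesFunction.measure_Ioc, Ne, ENNReal.ofReal_eq_zero, not_le] at hne
  exact sub_pos.1 hne

/-- The quantile function inverts the Gaussian distribution function. -/
lemma mul_gaussianQuantile_le_iff {σ : ℝ} (hσ : 0 < σ) (p L : ℝ) :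
    (σ : EReal) * gaussianQuantile p ≤ (L : EReal) ↔ p ≤ cdf (gaussianReal 0 1) (L / σ) := by
  rw [mul_comm, ← EReal.le_div_iff_mul_le (EReal.coe_pos.2 hσ) (EReal.coe_ne_top σ),
    ← EReal.coe_div, gaussianQuantile, sSup_le_iff]
  simp only [Set.forall_mem_image, Set.mem_ofPred_eq, EReal.coe_le_coe_iff]
  constructor
  · intro h
    by_contra! hlt
    -- If `Φ(L / σ) < p`, right continuity gives a point beyond `L / σ` still in the set defining
    -- the supremum.
    have hright := ((cdf (gaussianReal 0 1)).right_continuous (L / σ)).mono Set.Ioi_subset_Ici_self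
    obtain ⟨y, hy, hyL⟩ := ((hright.eventually_lt_const hlt).and self_mem_nhdsWithin).exists
    exact (h hy.le).not_gt hyL
  · intro h y hy
    exact strictMono_cdf_gaussianReal.le_iff_le.1 (hy.trans h)

end GaussianMarginals

end SlepianWolf

/-! ### The five boundary cases -/

open SlepianWolf
theorem mainTheorem5 {𝒳₁ 𝒳₂ : Type*} [Fintype 𝒳₁] [Fintype 𝒳₂] (P : 𝒳₁ × 𝒳₂ → ℝ)
    (hP : P ∈ stdSimplex ℝ (𝒳₁ × 𝒳₂)) (hV : (dispersion P).PosDef) (ε R₁ R₂ : ℝ) :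
    -- vertical boundary
    (R₁ = condEntropy₁ P → entropy (marg₂ P) < R₂ →
      secondOrderRegion P ε R₁ R₂ =
        {L | ((√(dispersion P 0 0) : ℝ) : EReal) * gaussianQuantile (1 - ε) ≤ (L.1 : EReal)}) ∧
    -- diagonal face
    (R₁ + R₂ = entropy P → condEntropy₁ P < R₁ → R₁ < entropy (marg₁ P) →
      secondOrderRegion P ε R₁ R₂ =
        {L | ((√(dispersion P 2 2) : ℝ) : EReal) * gaussianQuantile (1 - ε) ≤
          ((L.1 + L.2 : ℝ) : EReal)}) ∧
    -- top-left corner point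
    (R₁ = condEntropy₁ P → R₂ = entropy (marg₂ P) →
      secondOrderRegion P ε R₁ R₂ =
        {L | 1 - ε ≤ bivariateGaussianCDF L.1 (L.1 + L.2) 0 (dispersion₁ P)}) ∧
    -- horizontal boundary
    (R₂ = condEntropy₂ P → entropy (marg₁ P) < R₁ →
      secondOrderRegion P ε R₁ R₂ =
        {L | ((√(dispersion P 1 1) : ℝ) : EReal) * gaussianQuantile (1 - ε) ≤ (L.2 : EReal)}) ∧
    -- bottom-right corner point
    (R₂ = condEntropy₂ P → R₁ = entropy (marg₁ P) →
      secondOrderRegion P ε R₁ R₂ =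
        {L | 1 - ε ≤ bivariateGaussianCDF L.2 (L.1 + L.2) 0 (dispersion₂ P)}) := by
  have hc₁ := entropy_eq_condEntropy₁_add hP
  have hc₂ := entropy_eq_condEntropy₂_add hP
  have hI₂ := condEntropy₂_lt_entropy_marg₂ hP hV
  have hpos₁ := sum_mul_entropyDensity_pos hP hV 0
  have hpos₂ := sum_mul_entropyDensity_pos hP hV 1
  rw [sum_mul_entropyDensity_zero] at hpos₁
  rw [sum_mul_entropyDensity_one] at hpos₂
  have hdiag (k : Fin 3) : 0 < √(dispersion P k k) := Real.sqrt_pos.2 hV.diag_pos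
  -- `s` lists the constraints met with equality. In each case below, `hc₁`, `hc₂` and `hI₂` give
  -- the remaining strict inequalities linearly.
  have key (s : Finset (Fin 3)) (h₁ : 0 < R₁) (h₂ : 0 < R₂)
      (hs₀ : if 0 ∈ s then R₁ = condEntropy₁ P else condEntropy₁ P < R₁)
      (hs₁ : if 1 ∈ s then R₂ = condEntropy₂ P else condEntropy₂ P < R₂)
      (hs₂ : if 2 ∈ s then R₁ + R₂ = entropy P else entropy P < R₁ + R₂) (L : ℝ × ℝ) :
      L ∈ secondOrderRegion P ε R₁ R₂ ↔ 1 - ε ≤ (multivariateGaussian 0 (dispersion P)).real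
        (lowerOrthant s ![L.1, L.2, L.1 + L.2]) := by
    refine mem_secondOrderRegion_iff hP hV s h₁ h₂ ?_ ?_ ε L.1 L.2
    · refine Fin.forall_fin_succ.2 ⟨fun h => ?_, Fin.forall_fin_succ.2 ⟨fun h => ?_,
        Fin.forall_fin_succ.2 ⟨fun h => ?_, fun i => i.elim0⟩⟩⟩
      · exact ((if_pos h).mp hs₀).trans (sum_mul_entropyDensity_zero P).symm
      · exact ((if_pos h).mp hs₁).trans (sum_mul_entropyDensity_one P).symm
      · exact ((if_pos h).mp hs₂).trans (sum_mul_entropyDensity_two P).symm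
    · refine Fin.forall_fin_succ.2 ⟨fun h => ?_, Fin.forall_fin_succ.2 ⟨fun h => ?_,
        Fin.forall_fin_succ.2 ⟨fun h => ?_, fun i => i.elim0⟩⟩⟩
      · exact (sum_mul_entropyDensity_zero P).trans_lt ((if_neg h).mp hs₀)
      · exact (sum_mul_entropyDensity_one P).trans_lt ((if_neg h).mp hs₁)
      · exact (sum_mul_entropyDensity_two P).trans_lt ((if_neg h).mp hs₂)
  refine ⟨fun h h' => ?_, fun h h' h'' => ?_, fun h h' => ?_, fun h h' => ?_, fun h h' => ?_⟩
  · ext L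
    refine (key {0} (by linarith) (by linarith) (by simpa using h) (by simp; linarith)
      (by simp; linarith) L).trans ?_
    rw [lowerOrthant_singleton_real hV]
    exact (mul_gaussianQuantile_le_iff (hdiag 0) _ _).symm
  · ext L
    refine (key {2} (by linarith) (by linarith) (by simpa using h') (by simp; linarith)
      (by simpa using h) L).trans ?_
    rw [lowerOrthant_singleton_real hV]
    exact (mul_gaussianQuantile_le_iff (hdiag 2) _ _).symm
  · ext L
    refine (key {0, 2} (by linarith) (by linarith) (by simpa using h) (by simp; linarith)
      (by simp; linarith) L).trans ?_
    rw [lowerOrthant_pair_real hV.posSemidef]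
    rfl
  · ext L
    refine (key {1} (by linarith) (by linarith) (by simp; linarith) (by simpa using h)
      (by simp; linarith) L).trans ?_
    rw [lowerOrthant_singleton_real hV]
    exact (mul_gaussianQuantile_le_iff (hdiag 1) _ _).symm
  · ext L
    refine (key {1, 2} (by linarith) (by linarith) (by simp; linarith) (by simpa using h)
      (by simp; linarith) L).trans ?_
    rw [lowerOrthant_pair_real hV.posSemidef]
    rfl
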